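/- **Notation.** Let $D_{\uparrow,1}$ (resp. $D_{\uparrow,\infty}$) be the set of non-decreasing, right-continuous functions $\xi:[0,1]\to[0,\infty)$ (resp. $\xi:[0,\infty)\to[0,\infty)$), with the $\sigma$-algebra generated by the evaluations $\xi\mapsto\xi(t)$ and with the Skorokhod $J_1$ topology. For $\xi\in D_{\uparrow,\infty}$, $d\xi$ denotes the Radon measure on $[0,\infty)$ with distribution function $\xi$, and for $t>0$, $\gamma>0$, $(\Delta_{t,\gamma}\xi)(s):=t^{-\gamma}\xi(ts)$; elements of $D_{\uparrow,\infty}$ are restricted to $[0,1]$ where an element of $D_{\uparrow,1}$ is required. $C_B(Y)$ is the space of bounded continuous real functions on $Y$, and $C_{B,c}(D_{\uparrow,1})$ is the set of bounded measurable functions $g:D_{\uparrow,1}\to\mathbb R$ that are $J_1$-continuous at every continuous $\xi\in D_{\uparrow,1}$. Let $X$ be a Polish space, $m\neq0$ a $\sigma$-finite non-atomic Borel measure on $X$, and $T:X\to X$ an $m$-preserving transformation. Suppose $T$ is weakly rationally ergodic with return sequence $a(n)>0$ and ring $R(T)$: that is, $R(T)$ is a ring of Borel sets of finite measure which is hereditary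 ($A\in R(T)$ and $B\subset A$ Borel imply $B\in R(T)$), $T$-invariant ($A\in R(T)$ implies $T^{-1}A\in R(T)$) and dense (every Borel set of finite measure is approximated in measure by members of $R(T)$), and $$\frac1{a(n)}\sum_{k=0}^{n-1}m(A\cap T^{-k}B)\xrightarrow[n\to\infty]{}m(A)m(B)\qquad\forall\,A,B\in R(T).$$ Suppose that $a$ is $\gamma$-regularly varying with $\gamma\in(0,1]$, i.e. $a(\lfloor cn\rfloor)/a(n)\to c^\gamma$ for all $c>0$. For $f\in L^1(m)_+$ write $m(f)=\int_Xf\,dm$, $S_n(f)=\sum_{k=0}^{n-1}f\circ T^k$ and $\Psi_{n,f}(t):=S_{\lfloor nt\rfloor}(f)/a(n)$. **Proposition 4.** Let $\mathtt m_\gamma$ be a random variable in $D_{\uparrow,\infty}$ which is a.s. continuous with $\mathtt m_\gamma(0)=0$ a.s., and suppose that for every $f\in L^1(m)_+$, $\Psi_{n,f}\to m(f)\,\mathtt m_\gamma$ in distribution in $(D_{\uparrow,\infty},J_1)$ with respect to every $m$-absolutely continuous probability on $X$. Then there is a random variable $\mathtt w(\mathtt m_\gamma)$ in $D_{\uparrow,1}$,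 unique in law, with $$\mathbb E\,h(\mathtt w(\mathtt m_\gamma))=\mathbb E\int_0^1h(\Delta_{t,\gamma}\mathtt m_\gamma)\,d\mathtt m_\gamma(t)\qquad\forall\,h\in C_B(D_{\uparrow,1},J_1),$$ and for all $A,B\in R(T)$, $f\in L^1(m)_+$ and $g\in C_{B,c}(D_{\uparrow,1})$, $$\frac1{a(n)}\sum_{k=1}^n\int_Ag(\Psi_{k,f})\,1_B\circ T^k\,dm\xrightarrow[n\to\infty]{}m(A)\,m(B)\,\mathbb E\,g\big(m(f)\,\mathtt w(\mathtt m_\gamma)\big).$$ -/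

import Mathlib

open Set Filter Topology MeasureTheory
open scoped NNReal ENNReal BoundedContinuousFunction

noncomputable section

namespace TiedDown

/-- Non-decreasing, right-continuous functions `I → [0,∞)`, for an interval `I`: the distribution
functions of the Radon measures on `I`. -/
@[ext]
structure NonDec (I : Type*) [LinearOrder I] [TopologicalSpace I] where
  toFun : I → ℝ≥0
  mono : Monotone toFun
  right_cont : ∀ x, ContinuousWithinAt toFun (Ici x) x

instance (I : Type*) [LinearOrder I] [TopologicalSpace I] :
    CoeFun (NonDec I) (fun _ => I → ℝ≥0) := ⟨NonDec.toFun⟩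

/-- The interval `[0,1]`. -/
abbrev UnitI : Type := Icc (0 : ℝ≥0) 1

/-- The space `D_{↑,1}`. -/
abbrev DOne : Type := NonDec UnitI

/-- The space `D_{↑,∞}`. -/
abbrev DInf : Type := NonDec ℝ≥0

/-- The σ-algebra generated by the evaluations `ξ ↦ ξ t`. -/
instance (I : Type*) [LinearOrder I] [TopologicalSpace I] : MeasurableSpace (NonDec I) :=
  ⨆ t : I, MeasurableSpace.comap (fun ξ : NonDec I => ξ t) inferInstance

/-! ### The Skorokhod `J₁` topologies -/

/-- `‖log ℓ'‖_∞` of an increasing bijection `ℓ`, as the supremum of `|log|` of its slopes;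
it is finite exactly when `ℓ` is bi-Lipschitz. -/
def logSlope {I : Type*} [LinearOrder I] (coord : I → ℝ≥0) (ℓ : I ≃o I) : ℝ≥0∞ :=
  ⨆ (s : I) (t : I) (_ : s < t), ENNReal.ofReal
    |Real.log (((coord (ℓ t) : ℝ) - coord (ℓ s)) / ((coord t : ℝ) - coord s))|

/-- The `J₁` metric on `D_{↑,1}`. -/
def distOne (ξ η : DOne) : ℝ≥0∞ :=
  ⨅ ℓ : UnitI ≃o UnitI, (⨆ t : UnitI, edist (ξ t) (η (ℓ t))) + logSlope (fun t : UnitI => (t : ℝ≥0)) ℓ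

/-- The `J₁` metric on `D_{↑,∞}`. -/
def distInf (ξ η : DInf) : ℝ≥0∞ :=
  ⨅ ℓ : ℝ≥0 ≃o ℝ≥0, logSlope (fun t => t) ℓ +
    ∫⁻ u in Ici (0 : ℝ), ENNReal.ofReal (Real.exp (-u)) *
      min (⨆ t : ℝ≥0, edist (ξ (min t u.toNNReal)) (η (min (ℓ t) u.toNNReal))) 1

/-- The topology whose open sets are those containing a `d`-ball around each of their points. -/
@[reducible]
def ballTopology {E : Type*} (d : E → E → ℝ≥0∞) : TopologicalSpace E where
  IsOpen U := ∀ ξ ∈ U, ∃ ε : ℝ≥0∞, 0 < ε ∧ ∀ η, d ξ η < ε → η ∈ U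
  isOpen_univ := fun _ _ => ⟨1, one_pos, fun _ _ => mem_univ _⟩
  isOpen_inter := by
    intro U V hU hV ξ hξ
    obtain ⟨ε, hε, h⟩ := hU ξ hξ.1
    obtain ⟨δ, hδ, h'⟩ := hV ξ hξ.2
    exact ⟨min ε δ, lt_min hε hδ, fun η hη =>
      ⟨h η (hη.trans_le (min_le_left _ _)), h' η (hη.trans_le (min_le_right _ _))⟩⟩
  isOpen_sUnion := by
    intro S hS ξ hξ
    obtain ⟨U, hU, hξU⟩ := hξ
    obtain ⟨ε, hε, h⟩ := hS U hU ξ hξU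
    exact ⟨ε, hε, fun η hη => ⟨U, hU, h η hη⟩⟩

instance : TopologicalSpace DOne := ballTopology distOne

instance : TopologicalSpace DInf := ballTopology distInf

/-! ### Operations on non-decreasing functions -/

/-- The restriction of `ξ ∈ D_{↑,∞}` to `[0,1]`. -/
def NonDec.toOne (ξ : DInf) : DOne where
  toFun t := ξ (t : ℝ≥0)
  mono := fun _ _ h => ξ.mono h
  right_cont := fun x =>
    (ξ.right_cont (x : ℝ≥0)).comp continuous_subtype_val.continuousWithinAt (fun _ h => h)

/-- The multiple `c ξ`. -/
def NonDec.scale {I : Type*} [LinearOrder I] [TopologicalSpace I] (c : ℝ≥0) (ξ : NonDec I) :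
    NonDec I where
  toFun t := c * ξ t
  mono := fun _ _ h => mul_le_mul_right (ξ.mono h) c
  right_cont := fun x => (ξ.right_cont x).const_mul c

/-- The scaling `(Δ_{a,γ} ξ)(t) = ξ (a t) / a ^ γ`. -/
def NonDec.dilate (γ : ℝ) (a : ℝ≥0) (ξ : DInf) : DInf where
  toFun t := ξ (a * t) / a ^ γ
  mono := fun _ _ h => by
    exact div_le_div_of_nonneg_right (ξ.mono (mul_le_mul_right h a)) zero_le
  right_cont := fun x => by
    have h : ContinuousWithinAt (fun t : ℝ≥0 => a * t) (Ici x) x := by fun_prop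
    have h' := (ξ.right_cont (a * x)).comp h (fun _ ht => mul_le_mul_right ht a)
    exact h'.div_const _

/-- The Radon measure `μ` on `[0,∞)` with `μ [0,t] = ξ t` for all `t`. -/
def NonDec.measure (ξ : DInf) : Measure ℝ≥0 :=
  (ξ 0 : ℝ≥0∞) • Measure.dirac 0 +
    (StieltjesFunction.mk (fun t : ℝ≥0 => (ξ t : ℝ)) (fun _ _ h => ξ.mono h)
      (fun x => NNReal.continuous_coe.continuousAt.comp_continuousWithinAt
        (ξ.right_cont x))).measure

/-- Bounded measurable functions on `D_{↑,1}` that are `J₁`-continuous at each continuous `ξ`. -/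
structure IsCBc (g : DOne → ℝ) : Prop where
  measurable : Measurable g
  bounded : ∃ C : ℝ, ∀ ξ, |g ξ| ≤ C
  continuousAt : ∀ ξ : DOne, Continuous ξ.toFun → ContinuousAt g ξ

/-! ### Ergodic theory -/

theorem floor_right_cont (n : ℕ) (F : ℕ → ℝ≥0) (x : ℝ≥0) :
    ContinuousWithinAt (fun t : ℝ≥0 => F ⌊(n : ℝ≥0) * t⌋₊) (Ici x) x := by
  refine ContinuousWithinAt.congr_of_eventuallyEq
    (continuousWithinAt_const (b := F ⌊(n : ℝ≥0) * x⌋₊)) ?_ rfl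
  have hlt : (n : ℝ≥0) * x < (⌊(n : ℝ≥0) * x⌋₊ : ℝ≥0) + 1 := Nat.lt_floor_add_one _
  have hc : Continuous fun t : ℝ≥0 => (n : ℝ≥0) * t := by fun_prop
  filter_upwards [mem_nhdsWithin_of_mem_nhds (hc.continuousAt.eventually_lt
    continuousAt_const hlt), self_mem_nhdsWithin] with t ht hxt
  congr 1
  refine (Nat.floor_eq_iff zero_le).2 ⟨?_, ht⟩
  exact (Nat.floor_le zero_le).trans (mul_le_mul_right hxt _)

/-- The normalized Birkhoff-sum step function `Ψ_{n,f}(t) = S_{⌊nt⌋}(f) / a(n)` at the point `x`. -/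
def Psi {X : Type*} (T : X → X) (a : ℕ → ℝ≥0) (f : X → ℝ≥0) (n : ℕ) (x : X) : DInf where
  toFun t := birkhoffSum T f ⌊(n : ℝ≥0) * t⌋₊ x / a n
  mono := fun s t h => by
    have h1 : ⌊(n : ℝ≥0) * s⌋₊ ≤ ⌊(n : ℝ≥0) * t⌋₊ := Nat.floor_mono (mul_le_mul_right h _)
    have h2 : birkhoffSum T f ⌊(n : ℝ≥0) * s⌋₊ x ≤ birkhoffSum T f ⌊(n : ℝ≥0) * t⌋₊ x :=
      Finset.sum_le_sum_of_subset (Finset.range_mono h1)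
    exact div_le_div_of_nonneg_right h2 zero_le
  right_cont := fun x' => floor_right_cont n (fun k => birkhoffSum T f k x / a n) x'

/-- `(X,m,T)` is a weakly rationally ergodic measure preserving transformation with return
sequence `a` and with `R` as its dense, `T`-invariant, hereditary ring `R(T)`. -/
structure IsWeaklyRationallyErgodic {X : Type*} [MeasurableSpace X] (m : Measure X) (T : X → X)
    (a : ℕ → ℝ≥0) (R : Set (Set X)) : Prop where
  measurePreserving : MeasurePreserving T m m
  measurableSet : ∀ A ∈ R, MeasurableSet A
  measure_lt_top : ∀ A ∈ R, m A < ∞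
  ring : IsSetRing R
  hereditary : ∀ A ∈ R, ∀ B, MeasurableSet B → B ⊆ A → B ∈ R
  invariant : ∀ A ∈ R, T ⁻¹' A ∈ R
  dense : ∀ E, MeasurableSet E → m E < ∞ → ∀ ε : ℝ≥0∞, 0 < ε → ∃ A ∈ R, m (symmDiff A E) < ε
  pos : ∀ n, 1 ≤ n → 0 < a n
  tendsto : ∀ A ∈ R, ∀ B ∈ R,
    Tendsto (fun n : ℕ => 1 / (a n : ℝ) * ∑ k ∈ Finset.range n, m.real (A ∩ T^[k] ⁻¹' B))
      atTop (𝓝 (m.real A * m.real B))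

/-- The sequence `a` is regularly varying with index `γ`. -/
def IsRegularlyVarying (γ : ℝ) (a : ℕ → ℝ≥0) : Prop :=
  ∀ c : ℝ, 0 < c → Tendsto (fun n : ℕ => (a ⌊c * n⌋₊ : ℝ) / a n) atTop (𝓝 (c ^ γ))

/-- `f` is (a representative of) an element of `L¹(m)₊`. -/
def IsL1Pos {X : Type*} [MeasurableSpace X] (m : Measure X) (f : X → ℝ≥0) : Prop :=
  Measurable f ∧ ∫⁻ x, f x ∂m < ∞

/-- `m(f) = ∫ f dm`. -/
def integ {X : Type*} [MeasurableSpace X] (m : Measure X) (f : X → ℝ≥0) : ℝ≥0 :=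
  (∫⁻ x, f x ∂m).toNNReal

/-- Convergence `Y_n → Z` in distribution in `(D_{↑,∞}, J₁)` with respect to all `m`-absolutely
continuous probabilities, where `Z` is a random variable on `(Ω, P)`. -/
def StrongDistConv {X Ω : Type*} [MeasurableSpace X] [MeasurableSpace Ω] (m : Measure X)
    (Y : ℕ → X → DInf) (P : Measure Ω) (Z : Ω → DInf) : Prop :=
  ∀ Q : Measure X, IsProbabilityMeasure Q → Q ≪ m → ∀ F : DInf →ᵇ ℝ,
    Tendsto (fun n => ∫ x, F (Y n x) ∂Q) atTop (𝓝 (∫ ω, F (Z ω) ∂P))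

/-- `W` is the law of `w(M)`:
`E h(w(M)) = E ∫₀¹ h(Δ_{t,γ} M) dM(t)` for all bounded `J₁`-continuous `h` on `D_{↑,1}`. -/
def IsTiedDownLaw {Ω : Type*} [MeasurableSpace Ω] (γ : ℝ) (P : Measure Ω) (M : Ω → DInf)
    (W : ProbabilityMeasure DOne) : Prop :=
  ∀ h : DOne →ᵇ ℝ, ∫ ξ, h ξ ∂(W : Measure DOne) =
    ∫ ω, ∫ t in Icc (0 : ℝ≥0) 1, h ((M ω).dilate γ t).toOne ∂(M ω).measure ∂P

end TiedDown

end

open TiedDown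

noncomputable section

namespace TiedDown

/-! Write `B' = T ⁻¹' B`. For fixed `x` the sum over `1 ≤ k ≤ n`, divided by `a n`, is a Stieltjes
integral over `[0,1]`: the integrand is `t ↦ g (Ψ_{⌊nt⌋,f})` and the integrator is `Ψ_{n,1_{B'}}`
(`stepMeasure`). Up to the factor `a n / a ⌊nt⌋`, the path `Ψ_{⌊nt⌋,f}` is `Ψ_{n,f}` with time
rescaled by `⌊nt⌋ / n`. By regular variation it is therefore close to `Δ_{t,γ} Ψ_{n,f}`, locally
uniformly in `t > 0`. So along points where `Ψ_{n,f}` and `Ψ_{n,1_{B'}}` converge to `m(f) M` and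
`m(B) M`, the sum converges to `m(B) ∫₀¹ g (m(f) Δ_{t,γ} M) dM(t)`; this is
`tendsto_sum_of_tendsto_Psi`. Continuity of `M` makes pointwise convergence uniform on `[0,1]`, and
`M 0 = 0` makes the times near `0` negligible.

Two probabilistic facts turn this into convergence of means over `A`. First, the two paths converge
jointly (`tendsto_integral_lap_pair`). If `f` and `f'` have equal integrals, the hypothesis for `f +
f`, `f + f'` and `f' + f'` gives three equal limits, so the Laplace coordinates of the two paths
differ by `o(1)` in mean square, and both functions can be replaced by multiples of a single one.
Second, the occupation times of `B'` are uniformly integrable on `A`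
(`exists_integral_occ_tail_le`). Since the ring is hereditary, a union of small bad subsets of `A`
is again in the ring, and weak rational ergodicity for that union rules the bad sets out. An
extended continuous mapping theorem (`tendsto_integral_of_tendsto_of_uniformIntegrable`) then gives
the limit.

Taking `g = 1` and comparing with weak rational ergodicity gives `E M(1) = 1`, so `tiedDownMeasure`
is a probability.

The evaluation σ-algebra is never compared with the Borel sets of `J₁`. Paths are encoded by the
countably many numbers `exp (-∫₀^q ξ)`, `q` rational, which are `J₁`-continuous and generate the
evaluation σ-algebra; this gives uniqueness of the law and places the convergence argument in a
metric space. -/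

/-! ### Primitives of non-decreasing functions -/

/-- The primitive `∫₀^q ξ`. -/
def cumul (ξ : DInf) (q : ℝ≥0) : ℝ := ∫ s in (0 : ℝ)..q, (ξ s.toNNReal : ℝ)

theorem NonDec.monotone_real (ξ : DInf) : Monotone fun s : ℝ => (ξ s.toNNReal : ℝ) :=
  fun _ _ h => NNReal.coe_le_coe.2 (ξ.mono (Real.toNNReal_mono h))

theorem cumul_sub (ξ : DInf) (p q : ℝ≥0) :
    cumul ξ q - cumul ξ p = ∫ s in (p : ℝ)..q, (ξ s.toNNReal : ℝ) :=
  intervalIntegral.integral_interval_sub_left ξ.monotone_real.intervalIntegrable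
    ξ.monotone_real.intervalIntegrable

theorem mul_le_cumul_sub (ξ : DInf) {p q : ℝ≥0} (h : p ≤ q) :
    ((q : ℝ) - p) * ξ p ≤ cumul ξ q - cumul ξ p := by
  rw [cumul_sub]
  have := intervalIntegral.integral_mono_on (μ := volume) (a := (p : ℝ)) (b := q) (by exact_mod_cast h)
    (intervalIntegrable_const (c := (ξ p : ℝ)))
    ξ.monotone_real.intervalIntegrable (fun s hs => by
      simpa using ξ.monotone_real hs.1)
  simpa using this

theorem cumul_sub_le_mul (ξ : DInf) {p q : ℝ≥0} (h : p ≤ q) :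
    cumul ξ q - cumul ξ p ≤ ((q : ℝ) - p) * ξ q := by
  rw [cumul_sub]
  have := intervalIntegral.integral_mono_on (μ := volume) (a := (p : ℝ)) (b := q) (by exact_mod_cast h)
    ξ.monotone_real.intervalIntegrable
    (intervalIntegrable_const (c := (ξ q : ℝ))) (fun s hs => by
      simpa using ξ.monotone_real hs.2)
  simpa using this

theorem cumul_nonneg (ξ : DInf) (q : ℝ≥0) : 0 ≤ cumul ξ q :=
  intervalIntegral.integral_nonneg q.2 fun _ _ => NNReal.coe_nonneg _

theorem cumul_scale (c : ℝ≥0) (ξ : DInf) (q : ℝ≥0) : cumul (ξ.scale c) q = c * cumul ξ q := by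
  simp [cumul, NonDec.scale]

/-- A small multiplicative perturbation of time and a small additive perturbation of the values
change a primitive by little. -/
theorem exists_cumul_close (ξ : DInf) (q : ℝ≥0) (K : ℝ) {ε : ℝ} (hε : 0 < ε) :
    ∃ δ₀ > 0, ∀ δ, 0 < δ → δ < δ₀ → ∀ η : DInf,
      (∀ s : ℝ, 0 ≤ s → s ≤ q → (η s.toNNReal : ℝ) ≤ ξ (s * Real.exp δ).toNNReal + K * δ ∧
        (ξ (s * Real.exp (-δ)).toNNReal : ℝ) ≤ η s.toNNReal + K * δ) →
      |cumul η q - cumul ξ q| < ε := by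
  set f : ℝ → ℝ := fun s => (ξ s.toNNReal : ℝ) with hf
  have hfi : ∀ a b, IntervalIntegrable f volume a b :=
    fun a b => ξ.monotone_real.intervalIntegrable
  have hprim : Continuous fun b => ∫ s in (0 : ℝ)..b, f s :=
    intervalIntegral.continuous_primitive hfi 0
  -- For `σ = 1` and `σ = -1` these are the upper and lower bounds for `cumul η q`, after the
  -- substitution `s ↦ s * exp (σ * δ)`. They are continuous in `δ` even if `ξ` jumps, because
  -- primitives are continuous.
  have key : ∀ σ : ℝ, Tendsto (fun δ : ℝ => Real.exp (-(σ * δ)) *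
      (∫ s in (0 : ℝ)..q * Real.exp (σ * δ), f s) + σ * (q * (K * δ))) (𝓝 0) (𝓝 (cumul ξ q)) := by
    intro σ
    have hc : Continuous (fun δ : ℝ => Real.exp (-(σ * δ)) *
      (∫ s in (0 : ℝ)..q * Real.exp (σ * δ), f s) + σ * (q * (K * δ))) := by
      have : Continuous fun δ : ℝ => ∫ s in (0 : ℝ)..q * Real.exp (σ * δ), f s :=
        hprim.comp (by fun_prop)
      fun_prop
    simpa [cumul] using hc.tendsto 0
  have h1 := (key 1).eventually (gt_mem_nhds (lt_add_of_pos_right (cumul ξ q) hε))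
  have h2 := (key (-1)).eventually (lt_mem_nhds (sub_lt_self (cumul ξ q) hε))
  obtain ⟨δ₀, hδ₀, H⟩ := Metric.eventually_nhds_iff.1 (h1.and h2)
  refine ⟨δ₀, hδ₀, fun δ hδ hδ' η hη => ?_⟩
  obtain ⟨H1, H2⟩ := H (y := δ) (by simpa [abs_of_pos hδ] using hδ')
  have hcomp : ∀ r : ℝ, 0 < r → IntervalIntegrable (fun s => f (s * r)) volume 0 q := by
    intro r hr
    have : Monotone fun s => f (s * r) := fun s t hst =>
      ξ.monotone_real (mul_le_mul_of_nonneg_right hst hr.le)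
    exact this.intervalIntegrable
  have hηi : IntervalIntegrable (fun s : ℝ => (η s.toNNReal : ℝ)) volume 0 q :=
    η.monotone_real.intervalIntegrable
  have hcv : ∀ r : ℝ, 0 < r → ∫ s in (0 : ℝ)..q, f (s * r) = r⁻¹ * ∫ s in (0 : ℝ)..q * r, f s := by
    intro r hr
    rw [intervalIntegral.integral_comp_mul_right _ hr.ne']
    simp
  have up : cumul η q ≤ Real.exp (-(1 * δ)) *
      (∫ s in (0 : ℝ)..q * Real.exp (1 * δ), f s) + 1 * (q * (K * δ)) := by
    have := intervalIntegral.integral_mono_on (μ := volume) q.coe_nonneg hηi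
      ((hcomp _ (Real.exp_pos δ)).add (intervalIntegrable_const (c := K * δ)))
      (fun s hs => (hη s hs.1 hs.2).1)
    rw [intervalIntegral.integral_add (hcomp _ (Real.exp_pos δ)) (intervalIntegrable_const (c := K * δ)),
      hcv _ (Real.exp_pos δ)] at this
    simp [cumul, Real.exp_neg] at this ⊢
    linarith
  have lo : Real.exp (-(-1 * δ)) *
      (∫ s in (0 : ℝ)..q * Real.exp (-1 * δ), f s) + -1 * (q * (K * δ)) ≤ cumul η q := by
    have := intervalIntegral.integral_mono_on (μ := volume) q.coe_nonneg (hcomp _ (Real.exp_pos (-δ)))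
      (hηi.add (intervalIntegrable_const (c := K * δ)))
      (fun s hs => (hη s hs.1 hs.2).2)
    rw [intervalIntegral.integral_add hηi (intervalIntegrable_const (c := K * δ)),
      hcv _ (Real.exp_pos (-δ))] at this
    simp [cumul, Real.exp_neg] at this ⊢
    linarith
  rw [abs_lt]
  constructor <;> linarith

/-! ### Continuity for the Skorokhod topologies -/

/-- Openness only asks for a ball around each point, so neither the triangle inequality for `d` nor
openness of balls is needed. -/
theorem continuous_of_ballTopology {E F : Type*} [PseudoMetricSpace F] (d : E → E → ℝ≥0∞)
    (φ : E → F) (h : ∀ ξ, ∀ ε > 0, ∃ δ : ℝ≥0∞, 0 < δ ∧ ∀ η, d ξ η < δ → dist (φ η) (φ ξ) < ε) :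
    Continuous[ballTopology d, inferInstance] φ := by
  let _ : TopologicalSpace E := ballTopology d
  refine ⟨fun U hU ξ hξ => ?_⟩
  obtain ⟨ε, hε, hU'⟩ := Metric.isOpen_iff.1 hU _ hξ
  obtain ⟨δ, hδ, h'⟩ := h ξ ε hε
  exact ⟨δ, hδ, fun η hη => hU' (h' η hη)⟩

/-- The chord of `ℓ` from the fixed point `b` at coordinate `0` has slope `coord (ℓ t) / coord t`,
so a small `logSlope` makes the time change nearly the identity multiplicatively. -/
theorem mul_exp_bounds_of_logSlope_le {I : Type*} [LinearOrder I] {coord : I → ℝ≥0}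
    (hcoord : StrictMono coord) (ℓ : I ≃o I) {b : I} (hb : coord b = 0) (hℓ : ℓ b = b) {δ : ℝ}
    (hδ : 0 ≤ δ) (h : logSlope coord ℓ ≤ ENNReal.ofReal δ) (t : I) :
    (coord (ℓ t) : ℝ) ≤ coord t * Real.exp δ ∧ (coord t : ℝ) ≤ coord (ℓ t) * Real.exp δ := by
  have hbt : b ≤ t := not_lt.1 fun h' => by simpa [hb] using hcoord h'
  rcases hbt.eq_or_lt with rfl | hlt
  · simp [hb, hℓ]
  have h1 : ENNReal.ofReal |Real.log (((coord (ℓ t) : ℝ) - coord (ℓ b)) /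
      ((coord t : ℝ) - coord b))| ≤ logSlope coord ℓ :=
    le_iSup_of_le b (le_iSup_of_le t (le_iSup_of_le hlt le_rfl))
  have h2 := (ENNReal.ofReal_le_ofReal_iff hδ).1 (h1.trans h)
  rw [hℓ, hb] at h2
  simp only [NNReal.coe_zero, sub_zero] at h2
  have hct : (0 : ℝ) < coord t := by
    have := hcoord hlt; rw [hb] at this; exact_mod_cast this
  have hcl : (0 : ℝ) < coord (ℓ t) := by
    have := hcoord (ℓ.lt_iff_lt.2 hlt); rw [hℓ, hb] at this; exact_mod_cast this
  rw [Real.log_div hcl.ne' hct.ne', abs_le] at h2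
  constructor
  · calc (coord (ℓ t) : ℝ) = Real.exp (Real.log (coord (ℓ t))) := (Real.exp_log hcl).symm
      _ ≤ Real.exp (Real.log (coord t) + δ) := Real.exp_le_exp.2 (by linarith)
      _ = _ := by rw [Real.exp_add, Real.exp_log hct]
  · calc (coord t : ℝ) = Real.exp (Real.log (coord t)) := (Real.exp_log hct).symm
      _ ≤ Real.exp (Real.log (coord (ℓ t)) + δ) := Real.exp_le_exp.2 (by linarith)
      _ = _ := by rw [Real.exp_add, Real.exp_log hcl]

theorem continuous_cumul (q : ℝ≥0) : Continuous fun ξ : DInf => cumul ξ q := by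
  refine continuous_of_ballTopology distInf _ fun ξ ε hε => ?_
  -- On the window `u ≤ q * exp 1 + 1` the weight `exp (-u)` is at least `K⁻¹`, so a weighted error
  -- `δ` is a true error of at most `K * δ`.
  set K : ℝ := Real.exp (q * Real.exp 1 + 1) with hK
  obtain ⟨δ₀, hδ₀, H⟩ := exists_cumul_close ξ q K hε
  obtain ⟨δ, hδ, hδ'⟩ : ∃ δ, 0 < δ ∧ δ < min δ₀ (min 1 K⁻¹) :=
    exists_between (by positivity)
  rw [lt_min_iff, lt_min_iff] at hδ'
  refine ⟨ENNReal.ofReal δ, by simpa using hδ, fun η hη => ?_⟩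
  obtain ⟨ℓ, hℓ⟩ := iInf_lt_iff.1 hη
  have hslope : logSlope (fun t : ℝ≥0 => t) ℓ ≤ ENNReal.ofReal δ :=
    (le_self_add.trans_lt hℓ).le
  have hb := mul_exp_bounds_of_logSlope_le (coord := fun t : ℝ≥0 => t) strictMono_id ℓ
    (b := 0) rfl ℓ.map_bot hδ.le hslope
  -- The window has length one, so the weighted error cannot exceed `δ` throughout it. Since `δ <
  -- 1`, the times `s ≤ q` and `ℓ.symm s` stay below `q * exp 1 ≤ u`, where stopping at `u` has no
  -- effect.
  obtain ⟨u, hu, hu'⟩ : ∃ u ∈ Icc (q * Real.exp 1 : ℝ) (q * Real.exp 1 + 1),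
      ENNReal.ofReal (Real.exp (-u)) *
      min (⨆ t : ℝ≥0, edist (ξ (min t u.toNNReal)) (η (min (ℓ t) u.toNNReal))) 1
        ≤ ENNReal.ofReal δ := by
    by_contra! hcon
    have h1 : ENNReal.ofReal δ ≤ ∫⁻ u in Ici (0 : ℝ), ENNReal.ofReal (Real.exp (-u)) *
        min (⨆ t : ℝ≥0, edist (ξ (min t u.toNNReal)) (η (min (ℓ t) u.toNNReal))) 1 := by
      calc ENNReal.ofReal δ
          = ∫⁻ u in Icc (q * Real.exp 1 : ℝ) (q * Real.exp 1 + 1), ENNReal.ofReal δ := by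
            simp
        _ ≤ ∫⁻ u in Icc (q * Real.exp 1 : ℝ) (q * Real.exp 1 + 1), ENNReal.ofReal (Real.exp (-u)) *
            min (⨆ t : ℝ≥0, edist (ξ (min t u.toNNReal)) (η (min (ℓ t) u.toNNReal))) 1 :=
            setLIntegral_mono' measurableSet_Icc fun u hu => (hcon u hu).le
        _ ≤ _ := lintegral_mono_set fun u hu => le_trans (by positivity) hu.1
    exact absurd (h1.trans le_add_self) (not_le.2 hℓ)
  have hsup : (⨆ t : ℝ≥0, edist (ξ (min t u.toNNReal)) (η (min (ℓ t) u.toNNReal)))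
      ≤ ENNReal.ofReal (K * δ) := by
    have h1 : min (⨆ t : ℝ≥0, edist (ξ (min t u.toNNReal)) (η (min (ℓ t) u.toNNReal))) 1
        ≤ ENNReal.ofReal (K * δ) := by
      calc _ = ENNReal.ofReal (Real.exp u) * (ENNReal.ofReal (Real.exp (-u)) *
            min (⨆ t : ℝ≥0, edist (ξ (min t u.toNNReal)) (η (min (ℓ t) u.toNNReal))) 1) := by
            rw [← mul_assoc, ← ENNReal.ofReal_mul (Real.exp_pos _).le, ← Real.exp_add]
            simp
        _ ≤ ENNReal.ofReal (Real.exp u) * ENNReal.ofReal δ := by gcongr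
        _ ≤ ENNReal.ofReal K * ENNReal.ofReal δ := by
            gcongr; exact Real.exp_le_exp.2 hu.2
        _ = _ := (ENNReal.ofReal_mul (Real.exp_pos _).le).symm
    -- The cap at `1` is inactive because `δ < K⁻¹`.
    rcases min_le_iff.1 h1 with h | h
    · exact h
    · exfalso
      rw [ENNReal.one_le_ofReal] at h
      have : K * δ < K * K⁻¹ := by gcongr; exact hδ'.2.2
      rw [mul_inv_cancel₀ (Real.exp_pos _).ne'] at this
      linarith
  refine H δ hδ hδ'.1 η fun s hs hsq => ?_
  set s' : ℝ≥0 := s.toNNReal with hs'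
  have hs'c : (s' : ℝ) = s := Real.coe_toNNReal s hs
  set t : ℝ≥0 := ℓ.symm s' with ht
  have hlt : ℓ t = s' := by simp [ht]
  obtain ⟨hb1, hb2⟩ := hb t
  simp only [hlt] at hb1 hb2
  have hue : ∀ x : ℝ≥0, (x : ℝ) ≤ q * Real.exp 1 → min x u.toNNReal = x := fun x hx =>
    min_eq_left (NNReal.le_toNNReal_of_coe_le (hx.trans hu.1))
  have he : Real.exp δ ≤ Real.exp 1 := Real.exp_le_exp.2 hδ'.2.1.le
  have h1e : 1 ≤ Real.exp 1 := Real.one_le_exp zero_le_one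
  have htle : (t : ℝ) ≤ q * Real.exp 1 := hb2.trans (by
    rw [hs'c]; gcongr)
  have hsle : (s' : ℝ) ≤ q * Real.exp 1 := by
    rw [hs'c]; exact hsq.trans (le_mul_of_one_le_right q.2 h1e)
  have hdist : |(ξ t : ℝ) - η s'| ≤ K * δ := by
    have := (le_iSup (fun t : ℝ≥0 => edist (ξ (min t u.toNNReal)) (η (min (ℓ t) u.toNNReal))) t).trans
      hsup
    simp only [hlt] at this
    rw [hue t htle, hue s' hsle, edist_dist, ENNReal.ofReal_le_ofReal_iff (by positivity)] at this
    simpa [NNReal.dist_eq] using this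
  rw [abs_le] at hdist
  constructor
  · have : (ξ t : ℝ) ≤ ξ (s * Real.exp δ).toNNReal := NNReal.coe_le_coe.2 (ξ.mono
      (NNReal.le_toNNReal_of_coe_le (by rw [← hs'c]; exact hb2)))
    linarith
  · have : (ξ (s * Real.exp (-δ)).toNNReal : ℝ) ≤ ξ t := NNReal.coe_le_coe.2 (ξ.mono
      (Real.toNNReal_le_iff_le_coe.2 (by
        rw [Real.exp_neg, ← div_eq_mul_inv, div_le_iff₀ (Real.exp_pos _), ← hs'c]; exact hb1)))
    linarith

/-- The extension of `ξ ∈ D_{↑,1}` to `[0,∞)` which is constant on `[1,∞)`. -/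
def NonDec.extend (ξ : DOne) : DInf where
  toFun t := ξ ⟨min t 1, zero_le, min_le_right _ _⟩
  mono := fun _ _ h => ξ.mono (Subtype.coe_le_coe.1 (min_le_min_right 1 h))
  right_cont := fun x => by
    have h : Continuous fun t : ℝ≥0 => (⟨min t 1, zero_le, min_le_right _ _⟩ : UnitI) := by
      fun_prop
    exact (ξ.right_cont _).comp h.continuousWithinAt
      (fun _ ht => mem_Ici.2 (Subtype.coe_le_coe.1 (min_le_min_right 1 ht)))

theorem continuous_cumul_extend (q : ℝ≥0) : Continuous fun ξ : DOne => cumul ξ.extend q := by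
  refine continuous_of_ballTopology distOne _ fun ξ ε hε => ?_
  obtain ⟨δ₀, hδ₀, H⟩ := exists_cumul_close ξ.extend q 1 hε
  obtain ⟨δ, hδ, hδ'⟩ := exists_between hδ₀
  refine ⟨ENNReal.ofReal δ, by simpa using hδ, fun η hη => ?_⟩
  obtain ⟨ℓ, hℓ⟩ := iInf_lt_iff.1 hη
  have hslope : logSlope (fun t : UnitI => (t : ℝ≥0)) ℓ ≤ ENNReal.ofReal δ :=
    (le_add_self.trans_lt hℓ).le
  have hb := mul_exp_bounds_of_logSlope_le (coord := fun t : UnitI => (t : ℝ≥0))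
    (fun _ _ h => h) ℓ (b := ⊥) rfl ℓ.map_bot hδ.le hslope
  have hsup : ∀ t, |(ξ t : ℝ) - η (ℓ t)| ≤ δ := fun t => by
    have := (le_iSup (fun t : UnitI => edist (ξ t) (η (ℓ t))) t).trans (le_self_add.trans hℓ.le)
    rw [edist_dist, ENNReal.ofReal_le_ofReal_iff hδ.le] at this
    simpa [NNReal.dist_eq] using this
  have htop : ℓ ⊤ = ⊤ := ℓ.map_top
  refine H δ hδ hδ' η.extend fun s hs hsq => ?_
  rw [one_mul]
  set s' : UnitI := ⟨min s.toNNReal 1, zero_le, min_le_right _ _⟩ with hs'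
  have hηs : η.extend s.toNNReal = η s' := rfl
  set t : UnitI := ℓ.symm s' with ht
  have hlt : ℓ t = s' := by simp [ht]
  obtain ⟨hb1, hb2⟩ := hb t
  have hd := hsup t
  rw [hlt] at hb1 hb2 hd
  rw [abs_le] at hd
  rw [hηs]
  have hsc : ((s' : ℝ≥0) : ℝ) = min s 1 := by simp [hs', hs]
  rw [hsc] at hb1 hb2
  have he : 1 ≤ Real.exp δ := Real.one_le_exp hδ.le
  constructor
  · have : (ξ t : ℝ) ≤ ξ.extend (s * Real.exp δ).toNNReal := NNReal.coe_le_coe.2 (ξ.mono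
      (Subtype.coe_le_coe.1 (le_min (NNReal.le_toNNReal_of_coe_le (hb2.trans
        (by gcongr; exact min_le_left _ _))) t.2.2)))
    linarith
  · have : (ξ.extend (s * Real.exp (-δ)).toNNReal : ℝ) ≤ ξ t := by
      refine NNReal.coe_le_coe.2 (ξ.mono (Subtype.coe_le_coe.1 ?_))
      by_cases h1 : s ≤ 1
      · refine (min_le_left _ _).trans (Real.toNNReal_le_iff_le_coe.2 ?_)
        rw [Real.exp_neg, ← div_eq_mul_inv, div_le_iff₀ (Real.exp_pos _)]
        rwa [min_eq_left h1] at hb1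
      -- Beyond time `1` the extension is constant, and the time change fixes the right endpoint.
      · have : s' = ⊤ := Subtype.ext (by
          simpa [hs'] using (not_le.1 h1).le)
        have h2 : t = ⊤ := by rw [ht, this]; exact ℓ.symm.map_top
        rw [h2]; exact min_le_right _ _
    linarith

theorem distOne_le (ξ η : DOne) : distOne ξ η ≤ ⨆ t : UnitI, edist (ξ t) (η t) := by
  refine (iInf_le _ (OrderIso.refl _)).trans ?_
  have : logSlope (fun t : UnitI => (t : ℝ≥0)) (OrderIso.refl _) = 0 := by
    simp only [logSlope, ENNReal.iSup_eq_zero]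
    intro s t hst
    have : ((t : ℝ≥0) : ℝ) - (s : ℝ≥0) ≠ 0 := sub_ne_zero.2 (fun h => hst.ne' (Subtype.ext (NNReal.coe_injective h)))
    simp [div_self this]
  simp [this]

/-- Uniform convergence implies convergence for the Skorokhod topology. -/
theorem tendsto_of_tendstoUniformly {ι : Type*} {l : Filter ι} {ξ : ι → DOne} {η : DOne}
    (h : TendstoUniformly (fun i t => ξ i t) η l) : Tendsto ξ l (𝓝 η) := by
  rw [tendsto_nhds]
  intro U hU hη
  obtain ⟨ε, hε, hU'⟩ := hU η hη
  obtain ⟨δ, hδ, hδε⟩ := exists_between hε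
  filter_upwards [EMetric.tendstoUniformly_iff.1 h δ hδ] with i hi
  exact hU' _ (((distOne_le _ _).trans (iSup_le fun t => (hi t).le)).trans_lt hδε)

/-! ### Measurability -/

theorem measurable_eval {I : Type*} [LinearOrder I] [TopologicalSpace I] (t : I) :
    Measurable fun ξ : NonDec I => ξ t :=
  Measurable.of_comap_le (le_iSup (fun t : I =>
    MeasurableSpace.comap (fun ξ : NonDec I => ξ t) inferInstance) t)

theorem measurable_of_eval {I α : Type*} [LinearOrder I] [TopologicalSpace I] [MeasurableSpace α]
    {Φ : α → NonDec I} (h : ∀ t, Measurable fun a => Φ a t) : Measurable Φ := by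
  refine Measurable.of_le_map (iSup_le fun t => ?_)
  rw [MeasurableSpace.comap_le_iff_le_map, MeasurableSpace.map_comp]
  exact fun s hs => h t hs

theorem tendsto_floor_add_div (t : ℝ≥0) (c : ℕ) :
    Tendsto (fun n : ℕ => ((⌊((n : ℝ≥0) + 1) * t⌋₊ + c : ℕ) : ℝ≥0) / ((n : ℝ≥0) + 1)) atTop
      (𝓝 t) := by
  have hinv : Tendsto (fun n : ℕ => ((n : ℝ≥0) + 1)⁻¹) atTop (𝓝 0) := by
    rw [← NNReal.tendsto_coe]
    simpa using tendsto_one_div_add_atTop_nhds_zero_nat (𝕜 := ℝ)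
  have h1 : Tendsto (fun n : ℕ => t + (c : ℝ≥0) * ((n : ℝ≥0) + 1)⁻¹) atTop (𝓝 t) := by
    simpa using (tendsto_const_nhds (x := t)).add (hinv.const_mul (c : ℝ≥0))
  have h2 : Tendsto (fun n : ℕ => t - ((n : ℝ≥0) + 1)⁻¹) atTop (𝓝 t) := by
    simpa using (tendsto_const_nhds (x := t)).sub hinv
  refine tendsto_of_tendsto_of_tendsto_of_le_of_le h2 h1 (fun n => ?_) (fun n => ?_)
  · have hp : (0 : ℝ≥0) < (n : ℝ≥0) + 1 := by positivity
    rw [tsub_le_iff_right, ← one_div, ← add_div, le_div_iff₀ hp, mul_comm]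
    push_cast
    calc ((n : ℝ≥0) + 1) * t ≤ (⌊((n : ℝ≥0) + 1) * t⌋₊ : ℝ≥0) + 1 := (Nat.lt_floor_add_one _).le
      _ ≤ _ := by gcongr; exact le_self_add
  · have hp : (0 : ℝ≥0) < (n : ℝ≥0) + 1 := by positivity
    rw [div_le_iff₀ hp, add_mul t, mul_assoc, inv_mul_cancel₀ hp.ne', mul_one, mul_comm t]
    push_cast
    gcongr
    exact Nat.floor_le zero_le

theorem lt_floor_add_div (t : ℝ≥0) (n c : ℕ) (hc : 1 ≤ c) :
    t < ((⌊((n : ℝ≥0) + 1) * t⌋₊ + c : ℕ) : ℝ≥0) / ((n : ℝ≥0) + 1) := by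
  have hp : (0 : ℝ≥0) < (n : ℝ≥0) + 1 := by positivity
  rw [lt_div_iff₀ hp, mul_comm]
  refine (Nat.lt_floor_add_one _).trans_le ?_
  push_cast
  gcongr
  exact_mod_cast hc

theorem NonDec.tendsto_floor (ξ : DInf) (t : ℝ≥0) {c : ℕ} (hc : 1 ≤ c) :
    Tendsto (fun n : ℕ => ξ (((⌊((n : ℝ≥0) + 1) * t⌋₊ + c : ℕ) : ℝ≥0) / ((n : ℝ≥0) + 1))) atTop
      (𝓝 (ξ t)) :=
  (ξ.right_cont t).tendsto.comp (tendsto_nhdsWithin_iff.2 ⟨tendsto_floor_add_div t c,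
    Eventually.of_forall fun n => (lt_floor_add_div t n c hc).le⟩)

/-- Right-continuity gives the value at a varying time as a limit of values at grid points just to
its right; at each stage only countably many evaluations occur. -/
theorem measurable_eval_uncurry : Measurable fun p : DInf × ℝ≥0 => p.1 p.2 := by
  refine measurable_of_tendsto_metrizable
    (f := fun (n : ℕ) (p : DInf × ℝ≥0) =>
      p.1 (((⌊((n : ℝ≥0) + 1) * p.2⌋₊ + 1 : ℕ) : ℝ≥0) / ((n : ℝ≥0) + 1))) (fun n => ?_)
    (tendsto_pi_nhds.2 fun p => p.1.tendsto_floor p.2 le_rfl)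
  have h1 : Measurable fun p : DInf × ℕ => p.1 (((p.2 + 1 : ℕ) : ℝ≥0) / ((n : ℝ≥0) + 1)) :=
    measurable_from_prod_countable_left fun k =>
      measurable_eval (((k + 1 : ℕ) : ℝ≥0) / ((n : ℝ≥0) + 1))
  exact h1.comp (measurable_fst.prodMk
    (Nat.measurable_floor.comp (measurable_const.mul measurable_snd)))

theorem measurable_cumul (q : ℝ≥0) : Measurable fun ξ : DInf => cumul ξ q := by
  have h : Measurable fun p : DInf × ℝ => (p.1 p.2.toNNReal : ℝ) :=
    measurable_coe_nnreal_real.comp (measurable_eval_uncurry.comp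
      (measurable_fst.prodMk (measurable_real_toNNReal.comp measurable_snd)))
  simp only [cumul, intervalIntegral.integral_of_le q.coe_nonneg]
  exact (h.stronglyMeasurable.integral_prod_right (ν := volume.restrict (Ioc (0 : ℝ) q))).measurable

/-! ### Laplace coordinates -/

/-- An enumeration of the non-negative rationals. -/
def ratPt (p : ℕ × ℕ) : ℝ≥0 := p.1 / ((p.2 : ℝ≥0) + 1)

/-- The exponentials `exp (-∫₀^q ξ)` for rational `q`. -/
def lap (ξ : DInf) : ℕ × ℕ → ℝ := fun p => Real.exp (-cumul ξ (ratPt p))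

theorem lap_mem_Icc (ξ : DInf) (p : ℕ × ℕ) : lap ξ p ∈ Icc (0 : ℝ) 1 :=
  ⟨(Real.exp_pos _).le, Real.exp_le_one_iff.2 (neg_nonpos.2 (cumul_nonneg _ _))⟩

theorem continuous_lap : Continuous lap :=
  continuous_pi fun p => Real.continuous_exp.comp (continuous_cumul (ratPt p)).neg

theorem measurable_lap : Measurable lap :=
  measurable_pi_lambda _ fun p => (measurable_cumul (ratPt p)).neg.exp

theorem cumul_eq_neg_log_lap (ξ : DInf) (p : ℕ × ℕ) :
    cumul ξ (ratPt p) = -Real.log (lap ξ p) := by simp [lap]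

/-- The Laplace coordinates determine the path measurably: the difference quotient of the primitive
over the grid cell from `k + 1` to `k + 2`, just right of `t`, lies between the values at the ends
of the cell, and both tend to the value at `t`. -/
theorem measurable_of_lap {α : Type*} [MeasurableSpace α] {Φ : α → DInf}
    (h : Measurable fun a => lap (Φ a)) : Measurable Φ := by
  have hc : ∀ p, Measurable fun a => cumul (Φ a) (ratPt p) := fun p => by
    simp only [cumul_eq_neg_log_lap]
    exact ((measurable_pi_iff.1 h p).log).neg
  refine measurable_of_eval fun t => ?_
  have key : Measurable fun a => (Φ a t : ℝ) := by
    refine measurable_of_tendsto_metrizable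
      (f := fun (n : ℕ) a => ((n : ℝ) + 1) * (cumul (Φ a) (ratPt (⌊((n : ℝ≥0) + 1) * t⌋₊ + 2, n)) -
        cumul (Φ a) (ratPt (⌊((n : ℝ≥0) + 1) * t⌋₊ + 1, n))))
      (fun n => ((hc _).sub (hc _)).const_mul _) (tendsto_pi_nhds.2 fun a => ?_)
    have hlim : ∀ c, 1 ≤ c → Tendsto (fun n : ℕ =>
        (Φ a (ratPt (⌊((n : ℝ≥0) + 1) * t⌋₊ + c, n)) : ℝ)) atTop (𝓝 (Φ a t)) := fun c hc' =>
      (NNReal.continuous_coe.tendsto _).comp ((Φ a).tendsto_floor t hc')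
    have hd : ∀ n k : ℕ, ((n : ℝ) + 1) * ((ratPt (k + 2, n) : ℝ) - ratPt (k + 1, n)) = 1 := by
      intro n k
      simp only [ratPt]
      push_cast
      field_simp
      ring
    have hle : ∀ n k : ℕ, ratPt (k + 1, n) ≤ ratPt (k + 2, n) := fun n k => by
      simp only [ratPt]
      gcongr
      simp
    refine tendsto_of_tendsto_of_tendsto_of_le_of_le (hlim 1 le_rfl) (hlim 2 one_le_two)
      (fun n => ?_) (fun n => ?_)
    · have := mul_le_mul_of_nonneg_left (mul_le_cumul_sub (Φ a) (hle n ⌊((n : ℝ≥0) + 1) * t⌋₊))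
        (by positivity : (0 : ℝ) ≤ (n : ℝ) + 1)
      rwa [← mul_assoc, hd, one_mul] at this
    · have := mul_le_mul_of_nonneg_left (cumul_sub_le_mul (Φ a) (hle n ⌊((n : ℝ≥0) + 1) * t⌋₊))
        (by positivity : (0 : ℝ) ≤ (n : ℝ) + 1)
      rwa [← mul_assoc, hd, one_mul] at this
  simpa using key.real_toNNReal

theorem measurable_extend : Measurable NonDec.extend :=
  measurable_of_eval fun _ => measurable_eval _

theorem continuous_lap_extend : Continuous fun ξ : DOne => lap ξ.extend :=
  continuous_pi fun p => Real.continuous_exp.comp (continuous_cumul_extend (ratPt p)).neg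

theorem extend_coe (ξ : DOne) (t : UnitI) : ξ.extend t = ξ t :=
  congrArg ξ.toFun (Subtype.ext (min_eq_left t.2.2))

theorem measurableSpace_le_comap_lap_extend :
    (inferInstance : MeasurableSpace DOne) ≤
      MeasurableSpace.comap (fun ξ : DOne => lap ξ.extend) inferInstance := by
  refine iSup_le fun t => ?_
  rw [← measurable_iff_comap_le]
  have h : Measurable[MeasurableSpace.comap (fun ξ : DOne => lap ξ.extend) inferInstance]
      NonDec.extend :=
    @measurable_of_lap _ (MeasurableSpace.comap (fun ξ : DOne => lap ξ.extend) inferInstance) _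
      (comap_measurable _)
  simpa only [Function.comp_def, extend_coe] using (measurable_eval (t : ℝ≥0)).comp h

/-- Finite measures on `D_{↑,1}` are determined by the integrals of the bounded continuous
functions. -/
theorem ext_of_forall_integral_eq (μ ν : Measure DOne) [IsFiniteMeasure μ] [IsFiniteMeasure ν]
    (h : ∀ f : DOne →ᵇ ℝ, ∫ ξ, f ξ ∂μ = ∫ ξ, f ξ ∂ν) : μ = ν := by
  have hm : Measurable fun ξ : DOne => lap ξ.extend := measurable_lap.comp measurable_extend
  -- In the countable product of real lines, bounded continuous functions determine finite measures,
  -- and they pull back to `J₁`-continuous functions.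
  have key : μ.map (fun ξ : DOne => lap ξ.extend) = ν.map (fun ξ : DOne => lap ξ.extend) := by
    refine ext_of_forall_integral_eq_of_IsFiniteMeasure fun f => ?_
    have hf : ∀ ρ : Measure DOne, ∫ y, f y ∂(ρ.map fun ξ : DOne => lap ξ.extend) =
        ∫ ξ, f (lap ξ.extend) ∂ρ := fun ρ =>
      integral_map hm.aemeasurable f.continuous.aestronglyMeasurable
    rw [hf, hf]
    exact h (f.compContinuous ⟨_, continuous_lap_extend⟩)
  ext s hs
  obtain ⟨S, hS, rfl⟩ := measurableSpace_le_comap_lap_extend s hs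
  rw [← Measure.map_apply hm hS, key, Measure.map_apply hm hS]

/-! ### The extended continuous mapping theorem -/

/-- An infimum of `k`-Lipschitz functions with a common lower bound is `k`-Lipschitz; the cap `C`
makes the envelope a bounded test function. -/
theorem lowerEnvelope_lipschitz {ι E : Type*} [PseudoMetricSpace E] [Nonempty ι] (G : ι → ℝ) (y : ι → E) {C : ℝ}
    (hG : ∀ i, -C ≤ G i) (k : ℝ≥0) :
    LipschitzWith k fun z : E => min C (⨅ i, (G i + k * dist z (y i))) := by
  have hbdd : ∀ z, BddBelow (range fun i => G i + k * dist z (y i)) := fun z =>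
    ⟨-C, by rintro _ ⟨i, rfl⟩; exact (hG i).trans (le_add_of_nonneg_right (by positivity))⟩
  refine LipschitzWith.const_min (LipschitzWith.of_le_add_mul k fun z w => ?_) C
  rw [← sub_le_iff_le_add]
  refine le_ciInf fun i => ?_
  rw [sub_le_iff_le_add]
  refine (ciInf_le (hbdd z) i).trans ?_
  have := mul_le_mul_of_nonneg_left (dist_triangle z w (y i)) k.coe_nonneg
  linarith

section Mapping

variable {X Ω E : Type*} [MeasurableSpace X] [MeasurableSpace Ω] [PseudoMetricSpace E]
  [MeasurableSpace E] [BorelSpace E] {Q : Measure X} [IsProbabilityMeasure Q] {P : Measure Ω}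
  [IsProbabilityMeasure P] {Y : ℕ → X → E} {Z : Ω → E}

/-- `G n x` need not be a function of `Y n x`, so it is bounded below by one: `H k` is the
`k`-Lipschitz lower envelope of all values with index at least `k`. Convergence in distribution
applies to `H k`, and letting `k → ∞` recovers `G'` from below. -/
theorem eventually_lt_integral_of_tendsto (hY : ∀ n, AEMeasurable (Y n) Q) (hZ : AEMeasurable Z P)
    (hYZ : ∀ F : E → ℝ, (∃ K, LipschitzWith K F) → (∃ C, ∀ y, |F y| ≤ C) →
      Tendsto (fun n => ∫ x, F (Y n x) ∂Q) atTop (𝓝 (∫ ω, F (Z ω) ∂P)))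
    {G : ℕ → X → ℝ} {G' : Ω → ℝ} {C : ℝ} (hG : ∀ n x, |G n x| ≤ C) (hG' : ∀ ω, |G' ω| ≤ C)
    (hGm : ∀ n, AEStronglyMeasurable (G n) Q) (hGm' : AEStronglyMeasurable G' P)
    (hconv : ∀ᵐ ω ∂P, Tendsto (fun p : ℕ × X => G p.1 p.2)
      (comap Prod.fst atTop ⊓ comap (fun p => Y p.1 p.2) (𝓝 (Z ω))) (𝓝 (G' ω)))
    {ε : ℝ} (hε : 0 < ε) : ∀ᶠ n in atTop, ∫ ω, G' ω ∂P - ε < ∫ x, G n x ∂Q := by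
  obtain ⟨x₀⟩ : Nonempty X := nonempty_of_isProbabilityMeasure Q
  obtain ⟨ω₀⟩ : Nonempty Ω := nonempty_of_isProbabilityMeasure P
  have hC : 0 ≤ C := (abs_nonneg _).trans (hG' ω₀)
  have hne : ∀ k : ℕ, Nonempty {p : ℕ × X // k ≤ p.1} := fun k => ⟨⟨(k, x₀), le_rfl⟩⟩
  set H : ℕ → E → ℝ := fun k z =>
    min C (⨅ p : {p : ℕ × X // k ≤ p.1}, (G p.1.1 p.1.2 + (k : ℝ≥0) * dist z (Y p.1.1 p.1.2)))
    with hH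
  have hlow : ∀ (k : ℕ) (z : E) (p : {p : ℕ × X // k ≤ p.1}),
      -C ≤ G p.1.1 p.1.2 + (k : ℝ≥0) * dist z (Y p.1.1 p.1.2) := fun k z p =>
    (abs_le.1 (hG _ _)).1.trans (le_add_of_nonneg_right (by positivity))
  have hHL : ∀ k : ℕ, LipschitzWith (k : ℝ≥0) (H k) := fun k =>
    lowerEnvelope_lipschitz (fun p : {p : ℕ × X // k ≤ p.1} => G p.1.1 p.1.2)
      (fun p => Y p.1.1 p.1.2) (fun p => (abs_le.1 (hG _ _)).1) (k : ℝ≥0)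
  have hHC : ∀ k z, |H k z| ≤ C := fun k z =>
    abs_le.2 ⟨le_min (by linarith) (le_ciInf (hlow k z)), min_le_left _ _⟩
  have hHG : ∀ k n, k ≤ n → ∀ x, H k (Y n x) ≤ G n x := fun k n hkn x => by
    refine (min_le_right _ _).trans ((ciInf_le ⟨-C, ?_⟩ ⟨(n, x), hkn⟩).trans ?_)
    · rintro _ ⟨p, rfl⟩
      exact hlow k _ p
    · simp
  have hHZm : ∀ k, AEStronglyMeasurable (fun ω => H k (Z ω)) P := fun k =>
    ((hHL k).continuous.measurable.comp_aemeasurable hZ).aestronglyMeasurable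
  -- Only the lower bound on `H k (Z ω)` matters, hence the minimum with `G'`. Values attained near
  -- `Z ω` are almost `G' ω`; those at distance at least `δ` are penalised by `k * δ ≥ 2 * C`.
  have hpt : ∀ᵐ ω ∂P, Tendsto (fun k => min (H k (Z ω)) (G' ω)) atTop (𝓝 (G' ω)) := by
    filter_upwards [hconv] with ω hω
    rw [tendsto_order]
    refine ⟨fun b hb => ?_, fun b hb => Eventually.of_forall fun k => (min_le_right _ _).trans_lt hb⟩
    obtain ⟨b', hbb', hb'⟩ := exists_between hb
    have h1 := hω.eventually (lt_mem_nhds hb')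
    obtain ⟨N, δ, hδ, hN⟩ : ∃ N : ℕ, ∃ δ > 0, ∀ n ≥ N, ∀ x, dist (Y n x) (Z ω) < δ →
        b' < G n x := by
      obtain ⟨s, ⟨s', hs', hs⟩, t, ⟨t', ht', ht⟩, hst⟩ := Filter.mem_inf_iff_superset.1 h1
      obtain ⟨N, hN⟩ := mem_atTop_sets.1 hs'
      obtain ⟨δ, hδ, hδt⟩ := Metric.mem_nhds_iff.1 ht'
      exact ⟨N, δ, hδ, fun n hn x hx => @hst (n, x)
        ⟨hs (hN n hn), ht (hδt (Metric.mem_ball.2 hx))⟩⟩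
    obtain ⟨N', hN'⟩ := exists_nat_ge (2 * C / δ)
    filter_upwards [eventually_ge_atTop (max N N')] with k hk
    refine lt_min (hbb'.trans_le (le_min ?_ (le_ciInf fun p => ?_))) hb
    · exact hb'.le.trans (abs_le.1 (hG' ω)).2
    · by_cases hd : dist (Y p.1.1 p.1.2) (Z ω) < δ
      · exact (hN _ (((le_max_left _ _).trans hk).trans p.2) _ hd).le.trans
          (le_add_of_nonneg_right (by positivity))
      · have h2 : 2 * C ≤ k * dist (Z ω) (Y p.1.1 p.1.2) := by
          rw [dist_comm]
          calc 2 * C = 2 * C / δ * δ := by field_simp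
            _ ≤ k * dist (Y p.1.1 p.1.2) (Z ω) := by
              gcongr
              · exact hN'.trans (by exact_mod_cast (le_max_right _ _).trans hk)
              · exact not_lt.1 hd
        have h3 := (abs_le.1 (hG p.1.1 p.1.2)).1
        have h4 := (abs_le.1 (hG' ω)).2
        simp only [NNReal.coe_natCast]
        linarith
  have hlim : Tendsto (fun k => ∫ ω, min (H k (Z ω)) (G' ω) ∂P) atTop (𝓝 (∫ ω, G' ω ∂P)) := by
    refine tendsto_integral_of_dominated_convergence (fun _ => C)
      (fun k => (hHZm k).inf hGm') (integrable_const C) (fun k => ae_of_all _ fun ω => ?_) hpt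
    rw [Real.norm_eq_abs, abs_le]
    exact ⟨le_min (abs_le.1 (hHC k _)).1 (abs_le.1 (hG' ω)).1,
      (min_le_right _ _).trans (abs_le.1 (hG' ω)).2⟩
  obtain ⟨k, hk⟩ := (hlim.eventually (lt_mem_nhds (sub_lt_self _ hε))).exists
  have hHZi : Integrable (fun ω => H k (Z ω)) P :=
    (integrable_const C).mono' (hHZm k) (ae_of_all _ fun ω => hHC k _)
  have hk' : ∫ ω, G' ω ∂P - ε < ∫ ω, H k (Z ω) ∂P := hk.trans_le
    (integral_mono (hHZi.inf ((integrable_const C).mono' hGm' (ae_of_all _ hG'))) hHZi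
      fun ω => min_le_left _ _)
  filter_upwards [(hYZ (H k) ⟨_, hHL k⟩ ⟨C, hHC k⟩).eventually (lt_mem_nhds hk'),
    eventually_ge_atTop k] with n hn hkn
  refine hn.trans_le (integral_mono ?_ ?_ (hHG k n hkn))
  · exact (integrable_const C).mono'
      ((hHL k).continuous.measurable.comp_aemeasurable (hY n)).aestronglyMeasurable
      (ae_of_all _ fun x => hHC k _)
  · exact (integrable_const C).mono' (hGm n) (ae_of_all _ (hG n))

/-- The extended continuous mapping theorem for bounded functionals. -/
theorem tendsto_integral_of_tendsto_of_bounded (hY : ∀ n, AEMeasurable (Y n) Q)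
    (hZ : AEMeasurable Z P)
    (hYZ : ∀ F : E → ℝ, (∃ K, LipschitzWith K F) → (∃ C, ∀ y, |F y| ≤ C) →
      Tendsto (fun n => ∫ x, F (Y n x) ∂Q) atTop (𝓝 (∫ ω, F (Z ω) ∂P)))
    {G : ℕ → X → ℝ} {G' : Ω → ℝ} {C : ℝ} (hG : ∀ n x, |G n x| ≤ C) (hG' : ∀ ω, |G' ω| ≤ C)
    (hGm : ∀ n, AEStronglyMeasurable (G n) Q) (hGm' : AEStronglyMeasurable G' P)
    (hconv : ∀ᵐ ω ∂P, Tendsto (fun p : ℕ × X => G p.1 p.2)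
      (comap Prod.fst atTop ⊓ comap (fun p => Y p.1 p.2) (𝓝 (Z ω))) (𝓝 (G' ω))) :
    Tendsto (fun n => ∫ x, G n x ∂Q) atTop (𝓝 (∫ ω, G' ω ∂P)) := by
  rw [tendsto_order]
  constructor
  · intro b hb
    filter_upwards [eventually_lt_integral_of_tendsto hY hZ hYZ hG hG' hGm hGm' hconv
      (sub_pos.2 hb)] with n hn
    linarith
  · intro b hb
    have h := eventually_lt_integral_of_tendsto hY hZ hYZ (G := fun n x => -G n x)
      (G' := fun ω => -G' ω) (C := C) (by simpa using hG) (by simpa using hG')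
      (fun n => (hGm n).neg) hGm'.neg (by filter_upwards [hconv] with ω hω using hω.neg)
      (sub_pos.2 hb)
    filter_upwards [h] with n hn
    rw [integral_neg, integral_neg] at hn
    linarith

theorem abs_sub_clamp (K x : ℝ) (hK : 0 ≤ K) : |x - max (-K) (min K x)| = max (|x| - K) 0 := by
  rcases le_total 0 x with h | h
  · rw [abs_of_nonneg h, max_eq_right (le_min (by linarith) (by linarith))]
    rcases le_total K x with h' | h'
    · rw [min_eq_left h', max_eq_left (by linarith), abs_of_nonneg (by linarith)]
    · rw [min_eq_right h', max_eq_right (by linarith)]; simp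
  · rw [abs_of_nonpos h, min_eq_right (by linarith)]
    rcases le_total (-K) x with h' | h'
    · rw [max_eq_right h', max_eq_right (by linarith)]; simp
    · rw [max_eq_left h', max_eq_left (by linarith), abs_of_nonpos (by linarith)]; ring

theorem abs_clamp_le (K x : ℝ) (hK : 0 ≤ K) : |max (-K) (min K x)| ≤ K :=
  abs_le.2 ⟨le_max_left _ _, max_le (by linarith) (min_le_left _ _)⟩

theorem abs_integral_sub_integral_clamp_le {α : Type*} [MeasurableSpace α] {μ : Measure α}
    [IsFiniteMeasure μ] {φ : α → ℝ} (hφ : Integrable φ μ) {K : ℝ} (hK : 0 ≤ K) :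
    |∫ a, φ a ∂μ - ∫ a, max (-K) (min K (φ a)) ∂μ| ≤ ∫ a, max (|φ a| - K) 0 ∂μ := by
  rw [← integral_sub hφ]
  · refine (abs_integral_le_integral_abs).trans (le_of_eq ?_)
    exact integral_congr_ae (ae_of_all _ fun a => abs_sub_clamp _ _ hK)
  · exact (integrable_const K).mono'
      (aestronglyMeasurable_const.sup (aestronglyMeasurable_const.inf hφ.1))
      (ae_of_all _ fun a => abs_clamp_le _ _ hK)

/-- The extended continuous mapping theorem for uniformly integrable functionals. -/
theorem tendsto_integral_of_tendsto_of_uniformIntegrable (hY : ∀ n, AEMeasurable (Y n) Q)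
    (hZ : AEMeasurable Z P)
    (hYZ : ∀ F : E → ℝ, (∃ K, LipschitzWith K F) → (∃ C, ∀ y, |F y| ≤ C) →
      Tendsto (fun n => ∫ x, F (Y n x) ∂Q) atTop (𝓝 (∫ ω, F (Z ω) ∂P)))
    {G : ℕ → X → ℝ} {G' : Ω → ℝ} (hGi : ∀ n, Integrable (G n) Q)
    (hGm' : AEStronglyMeasurable G' P)
    (hUI : ∀ ε > 0, ∃ K, ∀ n, ∫ x, max (|G n x| - K) 0 ∂Q ≤ ε)
    (hconv : ∀ᵐ ω ∂P, Tendsto (fun p : ℕ × X => G p.1 p.2)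
      (comap Prod.fst atTop ⊓ comap (fun p => Y p.1 p.2) (𝓝 (Z ω))) (𝓝 (G' ω))) :
    Tendsto (fun n => ∫ x, G n x ∂Q) atTop (𝓝 (∫ ω, G' ω ∂P)) := by
  have hmax : ∀ (n : ℕ) (K : ℝ), Integrable (fun x => max (|G n x| - K) 0) Q := fun n K =>
    ((hGi n).abs.sub (integrable_const K)).pos_part
  have htrunc : ∀ K : ℝ, 0 ≤ K → Tendsto (fun n => ∫ x, max (-K) (min K (G n x)) ∂Q) atTop
      (𝓝 (∫ ω, max (-K) (min K (G' ω)) ∂P)) := fun K hK => by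
    refine tendsto_integral_of_tendsto_of_bounded hY hZ hYZ (C := K)
      (fun n x => abs_clamp_le K _ hK) (fun ω => abs_clamp_le K _ hK)
      (fun n => ?_) ?_ ?_
    · exact aestronglyMeasurable_const.sup (aestronglyMeasurable_const.inf (hGi n).1)
    · exact aestronglyMeasurable_const.sup (aestronglyMeasurable_const.inf hGm')
    · filter_upwards [hconv] with ω hω
      exact tendsto_const_nhds.max (tendsto_const_nhds.min hω)
  have habs : ∀ K : ℝ, 0 ≤ K → Tendsto (fun n => ∫ x, min K |G n x| ∂Q) atTop
      (𝓝 (∫ ω, min K |G' ω| ∂P)) := fun K hK => by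
    have hb : ∀ x : ℝ, |min K (|x|)| ≤ K := fun x => by
      rw [abs_of_nonneg (le_min hK (abs_nonneg _))]
      exact min_le_left _ _
    refine tendsto_integral_of_tendsto_of_bounded hY hZ hYZ (C := K)
      (fun n x => hb _) (fun ω => hb _) (fun n => ?_) ?_ ?_
    · exact aestronglyMeasurable_const.inf (hGi n).1.norm
    · exact aestronglyMeasurable_const.inf hGm'.norm
    · filter_upwards [hconv] with ω hω
      exact tendsto_const_nhds.min hω.abs
  -- Fatou: the truncated means of `|G'|` are limits of those of `|G n|`, which uniform
  -- integrability bounds by `1 + K₁`.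
  have hGi' : Integrable G' P := by
    obtain ⟨K₁, hK₁⟩ := hUI 1 one_pos
    have hle : ∀ K : ℕ, ∫ ω, min (K : ℝ) |G' ω| ∂P ≤ 1 + K₁ := fun K => by
      refine le_of_tendsto (habs K K.cast_nonneg) (Eventually.of_forall fun n => ?_)
      have h1 : ∫ x, min (K : ℝ) |G n x| ∂Q ≤ ∫ x, (max (|G n x| - K₁) 0 + K₁) ∂Q := by
        refine integral_mono_of_nonneg
          (ae_of_all _ fun x => le_min K.cast_nonneg (abs_nonneg _))
          ((hmax n K₁).add (integrable_const _)) (ae_of_all _ fun x => ?_)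
        refine (min_le_right _ _).trans ?_
        have := le_max_left (|G n x| - K₁) 0
        linarith
      rw [integral_add (hmax n K₁) (integrable_const _)] at h1
      simp at h1
      linarith [hK₁ n]
    refine ⟨hGm', ?_⟩
    have hlim : ∀ ω, Tendsto (fun K : ℕ => ENNReal.ofReal (min (K : ℝ) |G' ω|)) atTop
        (𝓝 ‖G' ω‖ₑ) := fun ω => by
      rw [← ofReal_norm, Real.norm_eq_abs]
      refine (tendsto_congr' ?_).2 tendsto_const_nhds
      obtain ⟨N, hN⟩ := exists_nat_ge |G' ω|
      filter_upwards [eventually_ge_atTop N] with k hk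
      rw [min_eq_right (hN.trans (by exact_mod_cast hk))]
    have hfat : ∫⁻ ω, ‖G' ω‖ₑ ∂P ≤
        liminf (fun K : ℕ => ∫⁻ ω, ENNReal.ofReal (min (K : ℝ) |G' ω|) ∂P) atTop := by
      calc ∫⁻ ω, ‖G' ω‖ₑ ∂P
          = ∫⁻ ω, liminf (fun K : ℕ => ENNReal.ofReal (min (K : ℝ) |G' ω|)) atTop ∂P :=
            lintegral_congr fun ω => (hlim ω).liminf_eq.symm
        _ ≤ _ := lintegral_liminf_le' fun K =>
            (aestronglyMeasurable_const.inf hGm'.norm).aemeasurable.ennreal_ofReal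
    refine lt_of_le_of_lt (hfat.trans ((?_ : _ ≤ ENNReal.ofReal (1 + K₁))))
      ENNReal.ofReal_lt_top
    refine liminf_le_of_le (by isBoundedDefault) fun b hb => ?_
    obtain ⟨K, hK⟩ := hb.exists
    refine hK.trans ?_
    rw [← ofReal_integral_eq_lintegral_ofReal]
    · exact ENNReal.ofReal_le_ofReal (hle K)
    · refine (integrable_const (K : ℝ)).mono' (aestronglyMeasurable_const.inf hGm'.norm)
        (ae_of_all _ fun ω => ?_)
      rw [Real.norm_eq_abs, abs_of_nonneg (le_min K.cast_nonneg (abs_nonneg _))]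
      exact min_le_left _ _
    · exact ae_of_all _ fun ω => le_min K.cast_nonneg (abs_nonneg _)
  have htail : Tendsto (fun K : ℕ => ∫ ω, max (|G' ω| - K) 0 ∂P) atTop (𝓝 0) := by
    have h0 : ∫ _, (0 : ℝ) ∂P = 0 := integral_zero Ω ℝ
    refine h0 ▸ tendsto_integral_of_dominated_convergence (F := fun (K : ℕ) ω => max (|G' ω| - K) 0)
      (fun ω => |G' ω|) (fun K => ?_) hGi'.abs
      (fun K => ae_of_all _ fun ω => ?_) (ae_of_all _ fun ω => ?_)
    · exact (hGi'.abs.sub (integrable_const (K : ℝ))).pos_part.1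
    · rw [Real.norm_eq_abs, abs_of_nonneg (le_max_right _ _)]
      exact max_le (by simp) (abs_nonneg _)
    · refine (tendsto_congr' ?_).2 tendsto_const_nhds
      obtain ⟨N, hN⟩ := exists_nat_ge |G' ω|
      filter_upwards [eventually_ge_atTop N] with k hk
      have : (N : ℝ) ≤ k := by exact_mod_cast hk
      exact max_eq_right (by linarith)
  rw [Metric.tendsto_atTop']
  intro ε hε
  obtain ⟨K₁, hK₁⟩ := hUI (ε / 4) (by linarith)
  obtain ⟨K, hKK₁, hK⟩ := ((tendsto_natCast_atTop_atTop.eventually_ge_atTop K₁).and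
    (htail.eventually (gt_mem_nhds (by linarith : 0 < ε / 4)))).exists
  have hK0 : (0 : ℝ) ≤ K := K.cast_nonneg
  obtain ⟨N, hN⟩ := Metric.tendsto_atTop.1 (htrunc K hK0) (ε / 4) (by linarith)
  refine ⟨N, fun n hn => ?_⟩
  have h1 := abs_integral_sub_integral_clamp_le (hGi n) hK0
  have h2 := abs_integral_sub_integral_clamp_le hGi' hK0
  have h3 := hN n hn.le
  have h4 : ∫ x, max (|G n x| - K) 0 ∂Q ≤ ε / 4 := (integral_mono (hmax n K) (hmax n K₁) fun x =>
    max_le_max_right 0 (by linarith)).trans (hK₁ n)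
  rw [Real.dist_eq] at h3 ⊢
  rw [abs_le] at h1 h2
  rw [abs_lt] at h3 ⊢
  constructor <;> linarith

end Mapping

/-! ### Convergence of non-decreasing functions -/

section Convergence

variable {J : Type*} {L : Filter J}

theorem exists_ratPt_btwn {s t : ℝ≥0} (h : s < t) : ∃ p, s < ratPt p ∧ ratPt p < t := by
  obtain ⟨q, hsq, hqt⟩ := exists_rat_btwn (NNReal.coe_lt_coe.2 h)
  have hq : 0 < q := by exact_mod_cast s.coe_nonneg.trans_lt hsq
  have hnum : ((q.num.toNat : ℕ) : ℝ) = (q.num : ℝ) := by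
    exact_mod_cast Int.toNat_of_nonneg (Rat.num_nonneg.2 hq.le)
  have hden : (((q.den - 1 : ℕ) : ℝ)) + 1 = q.den := by
    exact_mod_cast Nat.sub_add_cancel q.pos
  have hr : ((ratPt (q.num.toNat, q.den - 1) : ℝ≥0) : ℝ) = (q : ℝ) := by
    rw [ratPt, NNReal.coe_div, NNReal.coe_add, NNReal.coe_natCast, NNReal.coe_natCast,
      NNReal.coe_one, hnum, hden, Rat.cast_def]
  exact ⟨_, NNReal.coe_lt_coe.1 (by rw [hr]; exact hsq), NNReal.coe_lt_coe.1 (by rw [hr]; exact hqt)⟩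

/-- Convergence of the primitives at rational points implies pointwise convergence to a continuous
limit. -/
theorem tendsto_apply_of_tendsto_cumul {ξ : J → DInf} {η : DInf} (hη : Continuous η.toFun)
    (hη0 : η 0 = 0)
    (h : ∀ p, Tendsto (fun j => cumul (ξ j) (ratPt p)) L (𝓝 (cumul η (ratPt p)))) (t : ℝ≥0) :
    Tendsto (fun j => ξ j t) L (𝓝 (η t)) := by
  rw [tendsto_order]
  constructor
  · intro b hb
    -- The lower bound compares with averages to the left of `t`; at `t = 0` there is no such room,
    -- but `η 0 = 0` leaves nothing to prove.
    have ht : 0 < t := by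
      rcases eq_or_ne t 0 with rfl | ht
      · rw [hη0] at hb; exact absurd hb not_lt_zero
      · exact pos_iff_ne_zero.2 ht
    obtain ⟨r, hr, hr'⟩ := exists_Ioc_subset_of_mem_nhds
      (hη.continuousAt.eventually (lt_mem_nhds hb)) ⟨0, ht⟩
    obtain ⟨p, hp, hpt⟩ := exists_ratPt_btwn hr
    obtain ⟨q, hpq, hqt⟩ := exists_ratPt_btwn hpt
    have hbp : b < η (ratPt p) := hr' ⟨hp, hpt.le⟩
    have hpos : (0 : ℝ) < (ratPt q : ℝ) - ratPt p := sub_pos.2 (NNReal.coe_lt_coe.2 hpq)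
    have hlim : ((ratPt q : ℝ) - ratPt p) * b < cumul η (ratPt q) - cumul η (ratPt p) :=
      (mul_lt_mul_of_pos_left (NNReal.coe_lt_coe.2 hbp) hpos).trans_le (mul_le_cumul_sub η hpq.le)
    filter_upwards [((h q).sub (h p)).eventually (lt_mem_nhds hlim)] with j hj
    have h1 := lt_of_mul_lt_mul_left (hj.trans_le (cumul_sub_le_mul (ξ j) hpq.le)) hpos.le
    exact (NNReal.coe_lt_coe.1 h1).trans_le ((ξ j).mono hqt.le)
  · intro b hb
    obtain ⟨r, hr, hr'⟩ := exists_Ico_subset_of_mem_nhds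
      (hη.continuousAt.eventually (gt_mem_nhds hb)) ⟨t + 1, lt_add_one t⟩
    obtain ⟨q, htq, hqr⟩ := exists_ratPt_btwn hr
    obtain ⟨p, htp, hpq⟩ := exists_ratPt_btwn htq
    have hbq : η (ratPt q) < b := hr' ⟨htq.le, hqr⟩
    have hpos : (0 : ℝ) < (ratPt q : ℝ) - ratPt p := sub_pos.2 (NNReal.coe_lt_coe.2 hpq)
    have hlim : cumul η (ratPt q) - cumul η (ratPt p) < ((ratPt q : ℝ) - ratPt p) * b :=
      (cumul_sub_le_mul η hpq.le).trans_lt (mul_lt_mul_of_pos_left (NNReal.coe_lt_coe.2 hbq) hpos)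
    filter_upwards [((h q).sub (h p)).eventually (gt_mem_nhds hlim)] with j hj
    have h1 := lt_of_mul_lt_mul_left ((mul_le_cumul_sub (ξ j) hpq.le).trans_lt hj) hpos.le
    exact ((ξ j).mono htp.le).trans_lt (NNReal.coe_lt_coe.1 h1)

/-- Pointwise convergence of non-decreasing functions to a continuous limit is continuous
convergence. -/
theorem tendsto_apply_of_tendsto {I : Type*} [LinearOrder I] [TopologicalSpace I] [OrderTopology I]
    {ξ : J → NonDec I} {η : NonDec I} (hη : Continuous η.toFun)
    (h : ∀ t, Tendsto (fun j => ξ j t) L (𝓝 (η t))) {s : J → I} {t : I} (hs : Tendsto s L (𝓝 t)) :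
    Tendsto (fun j => ξ j (s j)) L (𝓝 (η t)) := by
  rw [tendsto_order]
  constructor
  · intro b hb
    obtain ⟨p, q, hpq, hn, hsub⟩ := exists_Icc_mem_subset_of_mem_nhds
      (hη.continuousAt.eventually (lt_mem_nhds hb))
    filter_upwards [hs hn, (h p).eventually
      (lt_mem_nhds (hsub ⟨le_rfl, hpq.1.trans hpq.2⟩ : b < η p))] with j hj hj'
    exact hj'.trans_le ((ξ j).mono hj.1)
  · intro b hb
    obtain ⟨p, q, hpq, hn, hsub⟩ := exists_Icc_mem_subset_of_mem_nhds
      (hη.continuousAt.eventually (gt_mem_nhds hb))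
    filter_upwards [hs hn, (h q).eventually
      (gt_mem_nhds (hsub ⟨hpq.1.trans hpq.2, le_rfl⟩ : η q < b))] with j hj hj'
    exact ((ξ j).mono hj.2).trans_lt hj'

theorem tendstoUniformlyOnFilter_of_tendsto {α β : Type*} [UniformSpace β] {F : J → α → β}
    {f : α → β} {p : Filter α} {b : β} (hf : Tendsto f p (𝓝 b))
    (hF : Tendsto (fun q : J × α => F q.1 q.2) (L ×ˢ p) (𝓝 b)) :
    TendstoUniformlyOnFilter F f L p := by
  rw [tendstoUniformlyOnFilter_iff_tendsto]
  exact ((hf.comp tendsto_snd).prodMk_nhds hF).mono_right (nhds_le_uniformity b)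

/-- Pointwise convergence of non-decreasing functions to a continuous limit implies convergence for
the Skorokhod topology. -/
theorem tendsto_of_tendsto_apply {ξ : J → DOne} {η : DOne} (hη : Continuous η.toFun)
    (h : ∀ t, Tendsto (fun j => ξ j t) L (𝓝 (η t))) : Tendsto ξ L (𝓝 η) := by
  refine tendsto_of_tendstoUniformly ?_
  -- Compactness of `[0,1]` reduces uniform convergence to joint convergence in the index and the
  -- time, which monotonicity supplies.
  rw [← tendstoLocallyUniformly_iff_tendstoUniformly_of_compactSpace,
    tendstoLocallyUniformly_iff_filter]
  intro t
  refine tendstoUniformlyOnFilter_of_tendsto (hη.tendsto t) ?_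
  exact tendsto_apply_of_tendsto (ξ := fun q : J × UnitI => ξ q.1) hη
    (fun t => (h t).comp tendsto_fst) tendsto_snd

/-! ### Convergence of integrals from convergence of distribution functions -/

/-- Error of a Riemann–Stieltjes sum, by induction on the number of cells: `[0, s 0]` is omitted
from the sum and costs the sup bound `C`, the other cells cost the oscillation `e`. -/
theorem abs_setIntegral_sub_sum_le {μ : Measure ℝ≥0} [IsFiniteMeasure μ] {φ : ℝ≥0 → ℝ}
    (hφm : Measurable φ) {C e : ℝ} (hφ : ∀ t, |φ t| ≤ C) {s : ℕ → ℝ≥0} (hs : Monotone s) {c : ℕ → ℝ}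
    (n : ℕ) (hc : ∀ i < n, ∀ t ∈ Ioc (s i) (s (i + 1)), |φ t - c i| ≤ e) :
    |∫ t in Icc 0 (s n), φ t ∂μ -
        ∑ i ∈ Finset.range n, c i * (μ.real (Icc 0 (s (i + 1))) - μ.real (Icc 0 (s i)))| ≤
      C * μ.real (Icc 0 (s 0)) + e * (μ.real (Icc 0 (s n)) - μ.real (Icc 0 (s 0))) := by
  have hInt : Integrable φ μ :=
    (integrable_const C).mono' hφm.aestronglyMeasurable (ae_of_all _ hφ)
  induction n with
  | zero =>
    simpa using norm_setIntegral_le_of_norm_le_const (f := φ) (measure_lt_top μ (Icc 0 (s 0)))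
      (fun t _ => hφ t)
  | succ n ih =>
    have hle : s n ≤ s (n + 1) := hs n.le_succ
    have hun : Icc 0 (s (n + 1)) = Icc 0 (s n) ∪ Ioc (s n) (s (n + 1)) :=
      (Icc_union_Ioc_eq_Icc zero_le hle).symm
    have hdisj : Disjoint (Icc 0 (s n)) (Ioc (s n) (s (n + 1))) :=
      Set.disjoint_left.2 fun t ht ht' => absurd ht.2 (not_le.2 ht'.1)
    have hI : ∫ t in Icc 0 (s (n + 1)), φ t ∂μ =
        ∫ t in Icc 0 (s n), φ t ∂μ + ∫ t in Ioc (s n) (s (n + 1)), φ t ∂μ := by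
      rw [hun, setIntegral_union hdisj measurableSet_Ioc hInt.integrableOn hInt.integrableOn]
    have hM : μ.real (Icc 0 (s (n + 1))) =
        μ.real (Icc 0 (s n)) + μ.real (Ioc (s n) (s (n + 1))) := by
      rw [hun, measureReal_union hdisj measurableSet_Ioc]
    have hlast : |∫ t in Ioc (s n) (s (n + 1)), φ t ∂μ - c n * μ.real (Ioc (s n) (s (n + 1)))| ≤
        e * μ.real (Ioc (s n) (s (n + 1))) := by
      have h1 : ∫ t in Ioc (s n) (s (n + 1)), φ t ∂μ - c n * μ.real (Ioc (s n) (s (n + 1))) =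
          ∫ t in Ioc (s n) (s (n + 1)), (φ t - c n) ∂μ := by
        rw [integral_sub hInt.integrableOn (integrable_const _)]
        simp [mul_comm]
      rw [h1]
      exact norm_setIntegral_le_of_norm_le_const (f := fun t => φ t - c n) (measure_lt_top μ _)
        (hc n n.lt_succ_self)
    have ih' := ih fun i hi => hc i (hi.trans n.lt_succ_self)
    rw [Finset.sum_range_succ, hI, hM]
    rw [abs_le] at ih' hlast ⊢
    constructor <;> linarith

/-- Weak convergence with varying integrands and no control of them at time `0`, where dilations
degenerate: small mass near `0` replaces uniformity there, and on `[δ,1]` both integrals are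
compared with the same finite sum. -/
theorem tendsto_setIntegral_of_tendsto_measure_Icc {μ : J → Measure ℝ≥0}
    [∀ j, IsFiniteMeasure (μ j)] {ν : Measure ℝ≥0} [IsFiniteMeasure ν]
    (hμ : ∀ t ≤ 1, Tendsto (fun j => (μ j).real (Icc 0 t)) L (𝓝 (ν.real (Icc 0 t))))
    (hν : Tendsto (fun t : ℝ≥0 => ν.real (Icc 0 t)) (𝓝 0) (𝓝 0))
    {φ : J → ℝ≥0 → ℝ} {h : ℝ≥0 → ℝ} {C : ℝ} (hφm : ∀ j, Measurable (φ j)) (hhm : Measurable h)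
    (hφ : ∀ j t, |φ j t| ≤ C) (hh : ∀ t, |h t| ≤ C) (hhc : ContinuousOn h (Ioc 0 1))
    (hφh : ∀ δ > 0, TendstoUniformlyOn φ h L (Icc δ 1)) :
    Tendsto (fun j => ∫ t in Icc 0 1, φ j t ∂(μ j)) L (𝓝 (∫ t in Icc 0 1, h t ∂ν)) := by
  have hC : 0 ≤ C := (abs_nonneg _).trans (hh 0)
  rw [Metric.tendsto_nhds]
  intro ε hε
  set K : ℝ := ν.real (Icc 0 1) + 1 with hK
  have hK0 : 0 < K := by positivity
  -- The errors are `C * e` twice from `[0,δ]`, `e * K` and `2 * e * K` from the oscillations, and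
  -- `e` from the sums; one spare `e` remains.
  set e : ℝ := ε / (2 * C + 3 * K + 2) with he
  have he0 : 0 < e := by positivity
  obtain ⟨δ, hδ, hδ1, hδe⟩ : ∃ δ : ℝ≥0, 0 < δ ∧ δ ≤ 1 ∧ ν.real (Icc 0 δ) < e := by
    obtain ⟨r, hr, hr'⟩ := exists_Ico_subset_of_mem_nhds
      (hν.eventually (gt_mem_nhds he0)) ⟨1, zero_lt_one⟩
    obtain ⟨δ, hδ, hδr⟩ := exists_between (lt_min hr zero_lt_one)
    rw [lt_min_iff] at hδr
    exact ⟨δ, hδ, hδr.2.le, hr' ⟨zero_le, hδr.1⟩⟩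
  have huc : UniformContinuousOn h (Icc δ 1) := isCompact_Icc.uniformContinuousOn_of_continuous
    (hhc.mono fun t ht => ⟨hδ.trans_le ht.1, ht.2⟩)
  obtain ⟨ρ, hρ, huc⟩ := Metric.uniformContinuousOn_iff.1 huc e he0
  obtain ⟨N, hN⟩ := exists_nat_one_div_lt hρ
  -- Clipping the uniform grid at `δ` gives a monotone partition from `δ` to `1`; repeated points
  -- only produce empty cells.
  set s : ℕ → ℝ≥0 := fun i => max δ (i / ((N : ℝ≥0) + 1)) with hs
  have hsm : Monotone s := fun i i' hii' => by
    simp only [hs]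
    gcongr
  have hs0 : s 0 = δ := by simp [hs]
  have hsN : s (N + 1) = 1 := by
    have : (((N + 1 : ℕ) : ℝ≥0) / ((N : ℝ≥0) + 1)) = 1 := by
      push_cast
      exact div_self (by positivity)
    simp only [hs, this]
    exact max_eq_right hδ1
  have hmem : ∀ i ≤ N + 1, s i ∈ Icc δ 1 := fun i hi => ⟨le_max_left _ _, hsN ▸ hsm hi⟩
  have hstep : ∀ i, (s (i + 1) : ℝ) ≤ s i + 1 / ((N : ℝ) + 1) := fun i => by
    have : s (i + 1) ≤ s i + 1 / ((N : ℝ≥0) + 1) := by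
      simp only [hs]
      refine max_le ((le_max_left _ _).trans le_self_add) ?_
      push_cast
      rw [add_div]
      gcongr
      exact le_max_right _ _
    exact_mod_cast this
  have hclose : ∀ i < N + 1, ∀ t ∈ Ioc (s i) (s (i + 1)), |h t - h (s (i + 1))| ≤ e := by
    intro i hi t ht
    have htm : t ∈ Icc δ 1 := ⟨(hmem i hi.le).1.trans ht.1.le, ht.2.trans (hmem _ hi).2⟩
    refine (huc t htm _ (hmem _ hi) ?_).le
    rw [NNReal.dist_eq, abs_sub_comm, abs_of_nonneg (sub_nonneg.2 (NNReal.coe_le_coe.2 ht.2))]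
    have := NNReal.coe_lt_coe.2 ht.1
    linarith [hstep i]
  have hsum : Tendsto (fun j => ∑ i ∈ Finset.range (N + 1), h (s (i + 1)) *
      ((μ j).real (Icc 0 (s (i + 1))) - (μ j).real (Icc 0 (s i)))) L
      (𝓝 (∑ i ∈ Finset.range (N + 1), h (s (i + 1)) *
        (ν.real (Icc 0 (s (i + 1))) - ν.real (Icc 0 (s i))))) := by
    refine tendsto_finsetSum _ fun i hi => Tendsto.const_mul _ ?_
    have hi' := Finset.mem_range.1 hi
    exact (hμ _ (hmem _ hi').2).sub (hμ _ (hmem _ hi'.le).2)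
  have hνb := abs_setIntegral_sub_sum_le (μ := ν) hhm hh hsm (N + 1) hclose
  filter_upwards [Metric.tendstoUniformlyOn_iff.1 (hφh δ hδ) e he0,
    Metric.tendsto_nhds.1 hsum e he0, (hμ δ hδ1).eventually (gt_mem_nhds hδe),
    (hμ 1 le_rfl).eventually (gt_mem_nhds (lt_add_one _))] with j hj1 hj2 hj3 hj4
  have hclosej : ∀ i < N + 1, ∀ t ∈ Ioc (s i) (s (i + 1)), |φ j t - h (s (i + 1))| ≤ 2 * e := by
    intro i hi t ht
    have htm : t ∈ Icc δ 1 := ⟨(hmem i hi.le).1.trans ht.1.le, ht.2.trans (hmem _ hi).2⟩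
    have h1 := hj1 t htm
    have h2 := hclose i hi t ht
    rw [Real.dist_eq, abs_lt] at h1
    rw [abs_le] at h2 ⊢
    constructor <;> linarith
  have hμb := abs_setIntegral_sub_sum_le (μ := μ j) (hφm j) (hφ j) hsm (N + 1) hclosej
  rw [hsN, hs0] at hνb hμb
  rw [Real.dist_eq] at hj2 ⊢
  have e1 : C * (μ j).real (Icc 0 δ) ≤ C * e := by gcongr
  have e2 : C * ν.real (Icc 0 δ) ≤ C * e := by gcongr
  have e3 : e * (ν.real (Icc 0 1) - ν.real (Icc 0 δ)) ≤ e * K := by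
    gcongr
    linarith [measureReal_nonneg (μ := ν) (s := Icc 0 δ)]
  have e4 : 2 * e * ((μ j).real (Icc 0 1) - (μ j).real (Icc 0 δ)) ≤ 2 * e * K := by
    gcongr
    linarith [measureReal_nonneg (μ := μ j) (s := Icc 0 δ)]
  have e5 : e * (2 * C + 3 * K + 2) = ε := div_mul_cancel₀ _ (by positivity)
  rw [abs_le] at hνb hμb
  rw [abs_lt] at hj2 ⊢
  constructor <;> linarith

end Convergence

/-! ### The measure of a non-decreasing function, and dilations -/

/-- There is nothing to the left of `0`, so the left limit there is `ξ 0` by convention and the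
Stieltjes measure has no atom at `0`; the Dirac term restores it. -/
theorem NonDec.measure_Icc_zero (ξ : DInf) (t : ℝ≥0) : ξ.measure (Icc 0 t) = ξ t := by
  have hbot : 𝓝[<] (0 : ℝ≥0) = ⊥ := by
    have : Iio (0 : ℝ≥0) = ∅ := by ext; simp
    rw [this, nhdsWithin_empty]
  rw [NonDec.measure, Measure.add_apply, Measure.smul_apply, StieltjesFunction.measure_Icc,
    leftLim_eq_of_eq_bot _ hbot, Measure.dirac_apply' _ measurableSet_Icc]
  have h : (ξ 0 : ℝ) ≤ ξ t := NNReal.coe_le_coe.2 (ξ.mono zero_le)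
  have h' : ENNReal.ofReal ((ξ t : ℝ) - ξ 0) = (ξ t : ℝ≥0∞) - ξ 0 := by
    rw [ENNReal.ofReal_sub _ NNReal.zero_le_coe, ENNReal.ofReal_coe_nnreal,
      ENNReal.ofReal_coe_nnreal]
  simp only [smul_eq_mul, mem_Icc, le_refl, zero_le, and_self, indicator_of_mem, Pi.one_apply,
    mul_one]
  change (ξ 0 : ℝ≥0∞) + ENNReal.ofReal ((ξ t : ℝ) - ξ 0) = ξ t
  rw [h', add_tsub_cancel_of_le (by exact_mod_cast ξ.mono zero_le)]

instance (ξ : DInf) : IsFiniteMeasure (ξ.measure.restrict (Icc 0 1)) :=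
  ⟨by rw [Measure.restrict_apply_univ, ξ.measure_Icc_zero]; exact ENNReal.coe_lt_top⟩

theorem NonDec.restrict_measure_Icc_zero (ξ : DInf) {t : ℝ≥0} (ht : t ≤ 1) :
    (ξ.measure.restrict (Icc 0 1)) (Icc 0 t) = ξ t := by
  rw [Measure.restrict_apply measurableSet_Icc, inter_eq_left.2 (Icc_subset_Icc_right ht),
    ξ.measure_Icc_zero]

theorem measurable_dilate_toOne (γ : ℝ) :
    Measurable fun p : DInf × ℝ≥0 => (p.1.dilate γ p.2).toOne := by
  refine measurable_of_eval fun s => ?_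
  change Measurable fun p : DInf × ℝ≥0 => p.1 (p.2 * s) / p.2 ^ γ
  exact (measurable_eval_uncurry.comp (measurable_fst.prodMk (measurable_snd.mul_const _))).div
    (measurable_snd.pow_const γ)

theorem measurable_scale {I : Type*} [LinearOrder I] [TopologicalSpace I] (c : ℝ≥0) :
    Measurable fun ξ : NonDec I => ξ.scale c :=
  measurable_of_eval fun t => (measurable_eval t).const_mul c

theorem measurable_toOne : Measurable NonDec.toOne :=
  measurable_of_eval fun t => measurable_eval (t : ℝ≥0)

theorem continuous_dilate_toOne {M : DInf} (hM : Continuous M.toFun) (γ : ℝ) (t : ℝ≥0) :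
    Continuous (M.dilate γ t).toOne.toFun := by
  change Continuous fun s : UnitI => M (t * s) / t ^ γ
  exact (hM.comp (by fun_prop)).div_const _

theorem continuous_scale {I : Type*} [LinearOrder I] [TopologicalSpace I] {ξ : NonDec I}
    (hξ : Continuous ξ.toFun) (c : ℝ≥0) : Continuous (ξ.scale c).toFun :=
  hξ.const_mul c

theorem tendsto_dilate_toOne {M : DInf} (hM : Continuous M.toFun) (γ : ℝ) (c : ℝ≥0) {t : ℝ≥0}
    (ht : 0 < t) : Tendsto (fun s => (M.dilate γ s).toOne.scale c) (𝓝 t)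
      (𝓝 ((M.dilate γ t).toOne.scale c)) := by
  refine tendsto_of_tendsto_apply (continuous_scale (continuous_dilate_toOne hM γ t) c) fun s => ?_
  change Tendsto (fun u : ℝ≥0 => c * (M (u * s) / u ^ γ)) (𝓝 t) (𝓝 (c * (M (t * s) / t ^ γ)))
  have h1 : Tendsto (fun u : ℝ≥0 => M (u * s)) (𝓝 t) (𝓝 (M (t * s))) :=
    (hM.comp (continuous_mul_const _)).tendsto t
  exact (h1.div ((NNReal.continuousAt_rpow_const (Or.inl ht.ne')).tendsto)
    (NNReal.rpow_pos ht).ne').const_mul c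

/-! ### Regular variation -/

theorem tendsto_floor_mul_div (t : ℝ≥0) :
    Tendsto (fun q : ℕ × ℝ≥0 => (⌊(q.1 : ℝ≥0) * q.2⌋₊ : ℝ≥0) / q.1) (atTop ×ˢ 𝓝 t) (𝓝 t) := by
  have hinv : Tendsto (fun q : ℕ × ℝ≥0 => ((q.1 : ℝ≥0))⁻¹) (atTop ×ˢ 𝓝 t) (𝓝 0) := by
    refine Tendsto.comp (g := fun n : ℕ => ((n : ℝ≥0))⁻¹) ?_ tendsto_fst
    rw [← NNReal.tendsto_coe]
    simpa using tendsto_inv_atTop_nhds_zero_nat (𝕜 := ℝ)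
  have hlow : Tendsto (fun q : ℕ × ℝ≥0 => q.2 - ((q.1 : ℝ≥0))⁻¹) (atTop ×ˢ 𝓝 t) (𝓝 t) := by
    simpa using (tendsto_snd (f := (atTop : Filter ℕ)) (g := 𝓝 t)).sub hinv
  have hpos : ∀ᶠ q : ℕ × ℝ≥0 in atTop ×ˢ 𝓝 t, (0 : ℝ≥0) < q.1 := by
    filter_upwards [tendsto_fst.eventually (eventually_gt_atTop 0)] with q hq
    exact_mod_cast hq
  refine tendsto_of_tendsto_of_tendsto_of_le_of_le' hlow tendsto_snd ?_ ?_
  · filter_upwards [hpos] with q hq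
    rw [tsub_le_iff_right, ← one_div, ← add_div, le_div_iff₀ hq, mul_comm]
    exact (Nat.lt_floor_add_one _).le
  · filter_upwards [hpos] with q hq
    rw [div_le_iff₀ hq, mul_comm q.2]
    exact Nat.floor_le zero_le

theorem floor_coe_nnreal (r : ℝ≥0) : ⌊(r : ℝ)⌋₊ = ⌊r⌋₊ := rfl

theorem tendsto_floor_mul_atTop {t : ℝ≥0} (ht : 0 < t) :
    Tendsto (fun q : ℕ × ℝ≥0 => ⌊(q.1 : ℝ≥0) * q.2⌋₊) (atTop ×ˢ 𝓝 t) atTop := by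
  obtain ⟨r, hr, hrt⟩ := exists_between ht
  have h1 : Tendsto (fun n : ℕ => ⌊(r : ℝ) * n⌋₊) atTop atTop :=
    tendsto_nat_floor_atTop.comp (tendsto_natCast_atTop_atTop.const_mul_atTop (by exact_mod_cast hr))
  refine tendsto_atTop_mono' _ ?_ (h1.comp tendsto_fst)
  filter_upwards [tendsto_snd.eventually (lt_mem_nhds hrt)] with q hq
  rw [← floor_coe_nnreal]
  refine Nat.floor_mono ?_
  push_cast
  rw [mul_comm]
  gcongr

/-- A regularly varying sequence which is asymptotically proportional to a monotone one is
regularly varying locally uniformly. -/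
theorem IsRegularlyVarying.tendsto_prod {γ : ℝ} {a : ℕ → ℝ≥0} (ha : IsRegularlyVarying γ a)
    (hpos : ∀ n, 1 ≤ n → 0 < a n) {S : ℕ → ℝ} (hS : Monotone S) {c₀ : ℝ} (hc₀ : 0 < c₀)
    (hSa : Tendsto (fun n => S n / a n) atTop (𝓝 c₀)) {t : ℝ≥0} (ht : 0 < t) :
    Tendsto (fun q : ℕ × ℝ≥0 => a ⌊(q.1 : ℝ≥0) * q.2⌋₊ / a q.1) (atTop ×ˢ 𝓝 t) (𝓝 (t ^ γ)) := by
  have hapos : ∀ᶠ n in atTop, (0 : ℝ) < a n := by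
    filter_upwards [eventually_ge_atTop 1] with n hn
    exact_mod_cast hpos n hn
  have hSpos : ∀ᶠ n in atTop, 0 < S n := by
    filter_upwards [hSa.eventually (lt_mem_nhds hc₀), hapos] with n h1 h2
    exact (div_pos_iff_of_pos_right h2).1 h1
  -- `S` inherits regular variation from `a`. Being monotone, it can be squeezed between fixed
  -- factors on either side of `t`; the resulting local uniformity is then passed back to `a`.
  have hSfl : ∀ c : ℝ, 0 < c → Tendsto (fun n : ℕ => S ⌊c * n⌋₊ / S n) atTop (𝓝 (c ^ γ)) := by
    intro c hc
    have hfl : Tendsto (fun n : ℕ => ⌊c * n⌋₊) atTop atTop :=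
      tendsto_nat_floor_atTop.comp (tendsto_natCast_atTop_atTop.const_mul_atTop hc)
    have h := ((hSa.comp hfl).mul (ha c hc)).div hSa hc₀.ne'
    rw [mul_div_cancel_left₀ _ hc₀.ne'] at h
    refine h.congr' ?_
    filter_upwards [hapos, hfl.eventually hapos, hSpos] with n h1 h2 h3
    simp only [Function.comp_apply, Pi.div_apply]
    field_simp
  have hfl := tendsto_floor_mul_atTop ht
  have hcont : ContinuousAt (fun c : ℝ => c ^ γ) t :=
    Real.continuousAt_rpow_const _ _ (Or.inl (by exact_mod_cast ht.ne'))
  have htR : (0 : ℝ) < t := by exact_mod_cast ht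
  have hcoe : Tendsto (fun q : ℕ × ℝ≥0 => (q.2 : ℝ)) (atTop ×ˢ 𝓝 t) (𝓝 t) :=
    (NNReal.continuous_coe.tendsto t).comp tendsto_snd
  have hSq : Tendsto (fun q : ℕ × ℝ≥0 => S ⌊(q.1 : ℝ≥0) * q.2⌋₊ / S q.1) (atTop ×ˢ 𝓝 t)
      (𝓝 ((t : ℝ) ^ γ)) := by
    rw [tendsto_order]
    constructor
    · intro b hb
      obtain ⟨r, hr, hr'⟩ := exists_Ioc_subset_of_mem_nhds
        (hcont.eventually (lt_mem_nhds hb)) ⟨0, htR⟩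
      obtain ⟨c, hc, hct⟩ := exists_between (max_lt hr htR)
      rw [max_lt_iff] at hc
      filter_upwards [tendsto_fst.eventually ((hSfl c hc.2).eventually
        (lt_mem_nhds (hr' ⟨hc.1, hct.le⟩ : b < c ^ γ))), tendsto_fst.eventually hSpos,
        hcoe.eventually (lt_mem_nhds hct)] with q h1 h2 h3
      refine h1.trans_le (div_le_div_of_nonneg_right (hS ?_) h2.le)
      rw [← floor_coe_nnreal]
      refine Nat.floor_mono ?_
      push_cast
      rw [mul_comm]
      gcongr
    · intro b hb
      obtain ⟨r, hr, hr'⟩ := exists_Ico_subset_of_mem_nhds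
        (hcont.eventually (gt_mem_nhds hb)) ⟨t + 1, lt_add_one _⟩
      obtain ⟨c, hc, hcr⟩ := exists_between hr
      filter_upwards [tendsto_fst.eventually ((hSfl c (htR.trans hc)).eventually
        (gt_mem_nhds (hr' ⟨hc.le, hcr⟩ : c ^ γ < b))), tendsto_fst.eventually hSpos,
        hcoe.eventually (gt_mem_nhds hc)] with q h1 h2 h3
      refine (div_le_div_of_nonneg_right (hS ?_) h2.le).trans_lt h1
      rw [← floor_coe_nnreal]
      refine Nat.floor_mono ?_
      push_cast
      rw [mul_comm]
      gcongr
  rw [← NNReal.tendsto_coe]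
  have h := (hSq.mul (hSa.comp tendsto_fst)).div (hSa.comp hfl) hc₀.ne'
  rw [mul_div_cancel_right₀ _ hc₀.ne'] at h
  push_cast
  refine h.congr' ?_
  filter_upwards [tendsto_fst.eventually hapos, hfl.eventually hapos, tendsto_fst.eventually hSpos,
    hfl.eventually hSpos] with q h1 h2 h3 h4
  simp only [Function.comp_apply, Pi.div_apply]
  field_simp

/-! ### Convergence along points where the occupation times converge -/

section Deterministic

variable {X J : Type*} {T : X → X} {a : ℕ → ℝ≥0} {f b : X → ℝ≥0} {γ : ℝ} {L : Filter J}
  {n : J → ℕ} {x : J → X} {M : DInf} {c c' : ℝ≥0}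

/-- Since `k * s = n * (k / n * s)`, the path at stage `k` is a time-scaled path at stage `n`, with
`a k / a n` in place of the exact power `(k / n) ^ γ`. -/
theorem Psi_eq_mul {k n : ℕ} (hn : n ≠ 0) (han : a n ≠ 0) (x : X) (s : ℝ≥0) :
    Psi T a f k x s = Psi T a f n x ((k : ℝ≥0) / n * s) * (a k / a n)⁻¹ := by
  have hn' : (n : ℝ≥0) ≠ 0 := by exact_mod_cast hn
  simp only [Psi]
  rw [← mul_assoc, mul_div_cancel₀ _ hn', inv_div, div_mul_div_cancel₀ han]

/-- Convergence is joint in the index and the time near `t`, as uniformity on compact subsets of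
`(0,1]` requires. It follows from `Psi_eq_mul`, with `⌊n * t⌋ / n` and `a ⌊n * t⌋ / a n` replaced by
their limits. -/
theorem tendsto_Psi_toOne (hpos : ∀ n, 1 ≤ n → 0 < a n) {t : ℝ≥0} (ht : 0 < t)
    (hreg : Tendsto (fun q : ℕ × ℝ≥0 => a ⌊(q.1 : ℝ≥0) * q.2⌋₊ / a q.1) (atTop ×ˢ 𝓝 t)
      (𝓝 (t ^ γ)))
    (hn : Tendsto n L atTop) (hM : Continuous M.toFun)
    (hf : ∀ t, Tendsto (fun j => Psi T a f (n j) (x j) t) L (𝓝 (c * M t))) :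
    Tendsto (fun q : J × ℝ≥0 => (Psi T a f ⌊(n q.1 : ℝ≥0) * q.2⌋₊ (x q.1)).toOne) (L ×ˢ 𝓝 t)
      (𝓝 ((M.dilate γ t).toOne.scale c)) := by
  have hprod : Tendsto (fun q : J × ℝ≥0 => (n q.1, q.2)) (L ×ˢ 𝓝 t) (atTop ×ˢ 𝓝 t) :=
    (hn.comp tendsto_fst).prodMk tendsto_snd
  refine tendsto_of_tendsto_apply (continuous_scale (continuous_dilate_toOne hM γ t) c) fun s => ?_
  change Tendsto (fun q : J × ℝ≥0 => Psi T a f ⌊(n q.1 : ℝ≥0) * q.2⌋₊ (x q.1) s) (L ×ˢ 𝓝 t)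
    (𝓝 (c * (M (t * s) / t ^ γ)))
  have h1 : Tendsto (fun q : J × ℝ≥0 => Psi T a f (n q.1) (x q.1)
      ((⌊(n q.1 : ℝ≥0) * q.2⌋₊ : ℝ≥0) / n q.1 * s)) (L ×ˢ 𝓝 t) (𝓝 (c * M (t * s))) :=
    tendsto_apply_of_tendsto (ξ := fun q : J × ℝ≥0 => Psi T a f (n q.1) (x q.1)) (η := M.scale c)
      (continuous_scale hM c) (fun t => (hf t).comp tendsto_fst)
      (((tendsto_floor_mul_div t).comp hprod).mul_const _)
  have h2 := h1.mul ((hreg.comp hprod).inv₀ (NNReal.rpow_pos ht).ne')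
  rw [← div_eq_mul_inv, mul_div_assoc] at h2
  refine h2.congr' ?_
  filter_upwards [tendsto_fst.eventually (hn.eventually (eventually_ge_atTop 1))] with q hq
  exact (Psi_eq_mul (Nat.one_le_iff_ne_zero.1 hq) (hpos _ hq).ne' _ _).symm

/-- The measure with distribution function `Psi T a b n x` on `[0,1]`. -/
def stepMeasure (T : X → X) (a : ℕ → ℝ≥0) (b : X → ℝ≥0) (n : ℕ) (x : X) : Measure ℝ≥0 :=
  ∑ i ∈ Finset.range n, (b (T^[i] x) / a n) • Measure.dirac (((i + 1 : ℕ) : ℝ≥0) / n)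

instance (n : ℕ) (x : X) : IsFiniteMeasure (stepMeasure T a b n x) := by
  unfold stepMeasure; infer_instance

theorem setIntegral_stepMeasure (n : ℕ) (x : X) (φ : ℝ≥0 → ℝ) :
    ∫ t in Icc 0 1, φ t ∂(stepMeasure T a b n x) =
      ∑ i ∈ Finset.range n, φ (((i + 1 : ℕ) : ℝ≥0) / n) * (b (T^[i] x) / a n : ℝ≥0) := by
  rw [← integral_indicator measurableSet_Icc, stepMeasure, integral_finsetSum_measure]
  · refine Finset.sum_congr rfl fun i hi => ?_
    rw [integral_smul_nnreal_measure, integral_dirac, indicator_of_mem, NNReal.smul_def, smul_eq_mul,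
      mul_comm]
    refine ⟨zero_le, div_le_one_of_le₀ ?_ zero_le⟩
    exact_mod_cast Finset.mem_range.1 hi
  · intro i _
    exact (integrable_dirac (by simp)).smul_measure_nnreal

/-- The visit at time `i` enters the Birkhoff sum only from index `i + 1` on, which is why its atom
sits at `(i + 1) / n`. -/
theorem stepMeasure_Icc {n : ℕ} (hn : n ≠ 0) (x : X) {t : ℝ≥0} (ht : t ≤ 1) :
    (stepMeasure T a b n x).real (Icc 0 t) = Psi T a b n x t := by
  have hn' : (0 : ℝ≥0) < n := by exact_mod_cast Nat.pos_of_ne_zero hn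
  have hle : ⌊(n : ℝ≥0) * t⌋₊ ≤ n := by
    refine Nat.floor_le_of_le ?_
    exact mul_le_of_le_one_right zero_le ht
  have hmem : ∀ i : ℕ, ((i + 1 : ℕ) : ℝ≥0) / n ∈ Icc 0 t ↔ i < ⌊(n : ℝ≥0) * t⌋₊ := fun i => by
    rw [← Nat.succ_le_iff, Nat.le_floor_iff zero_le, mem_Icc, div_le_iff₀ hn', mul_comm]
    simp
  have key : (stepMeasure T a b n x) (Icc 0 t) = (Psi T a b n x t : ℝ≥0) := by
    simp only [stepMeasure, Measure.coe_finsetSum, Finset.sum_apply, Measure.smul_apply,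
      Measure.dirac_apply' _ measurableSet_Icc]
    have : ∀ i ∈ Finset.range n, (b (T^[i] x) / a n) • (Icc 0 t).indicator (1 : ℝ≥0 → ℝ≥0∞)
        (((i + 1 : ℕ) : ℝ≥0) / n) = if i < ⌊(n : ℝ≥0) * t⌋₊ then
          ((b (T^[i] x) / a n : ℝ≥0) : ℝ≥0∞) else 0 := fun i _ => by
      by_cases h : i < ⌊(n : ℝ≥0) * t⌋₊
      · rw [indicator_of_mem ((hmem i).2 h), if_pos h]
        simp [ENNReal.smul_def]
      · rw [indicator_of_notMem (fun h' => h ((hmem i).1 h')), if_neg h, smul_zero]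
    rw [Finset.sum_congr rfl this, ← Finset.sum_filter]
    have hfil : (Finset.range n).filter (fun i => i < ⌊(n : ℝ≥0) * t⌋₊) =
        Finset.range ⌊(n : ℝ≥0) * t⌋₊ := by
      ext i
      simp only [Finset.mem_filter, Finset.mem_range]
      exact ⟨fun h => h.2, fun h => ⟨h.trans_le hle, h⟩⟩
    rw [hfil, ← ENNReal.ofNNReal_finsetSum, ← Finset.sum_div]
    rfl
  rw [Measure.real, key, ENNReal.coe_toReal]

/-- The sum integrates `t ↦ g (Psi ⌊n * t⌋)` against `stepMeasure`, since `⌊n * t⌋ = i + 1` at the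
atom `t = (i + 1) / n`. The distribution functions converge to `c' * M`, and `g` is continuous at
the limiting dilations because `M` is. -/
theorem tendsto_sum_of_tendsto_Psi (hpos : ∀ n, 1 ≤ n → 0 < a n)
    (hreg : ∀ t > 0, Tendsto (fun q : ℕ × ℝ≥0 => a ⌊(q.1 : ℝ≥0) * q.2⌋₊ / a q.1) (atTop ×ˢ 𝓝 t)
      (𝓝 (t ^ γ)))
    (hn : Tendsto n L atTop) (hM : Continuous M.toFun) (hM0 : M 0 = 0)
    (hf : ∀ t, Tendsto (fun j => Psi T a f (n j) (x j) t) L (𝓝 (c * M t)))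
    (hb : ∀ t, Tendsto (fun j => Psi T a b (n j) (x j) t) L (𝓝 (c' * M t)))
    {g : DOne → ℝ} (hg : IsCBc g) :
    Tendsto (fun j => ∑ i ∈ Finset.range (n j),
        g (Psi T a f (i + 1) (x j)).toOne * (b (T^[i] (x j)) / a (n j) : ℝ≥0)) L
      (𝓝 (c' * ∫ t in Icc 0 1, g ((M.dilate γ t).toOne.scale c) ∂M.measure)) := by
  obtain ⟨C, hC⟩ := hg.bounded
  have hn1 : ∀ᶠ j in L, n j ≠ 0 :=
    (hn.eventually (eventually_ge_atTop 1)).mono fun j hj => Nat.one_le_iff_ne_zero.1 hj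
  have hgM : ∀ t, ContinuousAt g ((M.dilate γ t).toOne.scale c) := fun t =>
    hg.continuousAt _ (continuous_scale (continuous_dilate_toOne hM γ t) c)
  have hhc : ∀ t > 0, Tendsto (fun s => g ((M.dilate γ s).toOne.scale c)) (𝓝 t)
      (𝓝 (g ((M.dilate γ t).toOne.scale c))) := fun t ht =>
    (hgM t).tendsto.comp (tendsto_dilate_toOne hM γ c ht)
  have hνr : ∀ t ≤ 1, (c' • M.measure.restrict (Icc 0 1)).real (Icc 0 t) = c' * M t :=
    fun t ht => by
      rw [measureReal_nnreal_smul_apply, Measure.real, M.restrict_measure_Icc_zero ht]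
      simp
  have key := tendsto_setIntegral_of_tendsto_measure_Icc (L := L)
    (μ := fun j => stepMeasure T a b (n j) (x j)) (ν := c' • M.measure.restrict (Icc 0 1))
    (φ := fun j t => g (Psi T a f ⌊(n j : ℝ≥0) * t⌋₊ (x j)).toOne)
    (h := fun t => g ((M.dilate γ t).toOne.scale c)) (C := C) ?_ ?_ ?_ ?_ (fun j t => hC _)
    (fun t => hC _) (fun t ht => (hhc t ht.1).mono_left nhdsWithin_le_nhds) ?_
  · simp only [setIntegral_stepMeasure] at key
    rw [Measure.restrict_smul, Measure.restrict_restrict_of_subset Subset.rfl,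
      integral_smul_nnreal_measure, NNReal.smul_def, smul_eq_mul] at key
    refine key.congr' ?_
    filter_upwards [hn1] with j hj
    refine Finset.sum_congr rfl fun i _ => ?_
    have hj' : (n j : ℝ≥0) ≠ 0 := by exact_mod_cast hj
    rw [mul_div_cancel₀ _ hj', Nat.floor_natCast]
  · intro t ht
    rw [hνr t ht]
    refine (Tendsto.congr' ?_ ((NNReal.continuous_coe.tendsto _).comp (hb t)))
    filter_upwards [hn1] with j hj
    exact (stepMeasure_Icc hj (x j) ht).symm
  · have h0 : Tendsto (fun t : ℝ≥0 => (c' * M t : ℝ)) (𝓝 0) (𝓝 0) := by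
      have : Continuous fun t : ℝ≥0 => (c' * M t : ℝ) :=
        continuous_const.mul (NNReal.continuous_coe.comp hM)
      simpa [hM0] using this.tendsto 0
    refine h0.congr' ?_
    filter_upwards [Iic_mem_nhds (zero_lt_one (α := ℝ≥0))] with t ht
    exact (hνr t ht).symm
  · intro j
    exact (measurable_from_nat (f := fun k => g (Psi T a f k (x j)).toOne)).comp
      (Nat.measurable_floor.comp (measurable_id.const_mul _))
  · exact hg.measurable.comp ((measurable_scale c).comp
      ((measurable_dilate_toOne γ).comp (measurable_const.prodMk measurable_id)))
  · intro δ hδ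
    rw [← tendstoLocallyUniformlyOn_iff_tendstoUniformlyOn_of_compact isCompact_Icc,
      tendstoLocallyUniformlyOn_iff_filter]
    intro t ht
    have ht0 : 0 < t := hδ.trans_le ht.1
    refine tendstoUniformlyOnFilter_of_tendsto ((hhc t ht0).mono_left nhdsWithin_le_nhds) ?_
    exact ((hgM t).tendsto.comp (tendsto_Psi_toOne hpos ht0 (hreg t ht0) hn hM hf)).mono_left
      (Filter.prod_mono le_rfl nhdsWithin_le_nhds)

end Deterministic

open ProbabilityTheory

/-! ### Measurable versions of continuous functions on `D_{↑,1}` -/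

/-- The step function with values `v₀ ≤ max v₀ v₁ ≤ …` on intervals of length `1 / N`. -/
def stepFun (N : ℕ) (v : ℕ → ℝ≥0) : DOne where
  toFun t := partialSups v ⌊(N : ℝ≥0) * t⌋₊
  mono := fun _ _ h => (partialSups v).monotone 
    (Nat.floor_mono (mul_le_mul_right (Subtype.coe_le_coe.2 h) _))
  right_cont := fun x => (floor_right_cont N (partialSups v) (x : ℝ≥0)).comp
    continuous_subtype_val.continuousWithinAt (fun _ h => h)

theorem floor_mul_le (N : ℕ) (t : UnitI) : ⌊(N : ℝ≥0) * t⌋₊ ≤ N :=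
  Nat.floor_le_of_le (mul_le_of_le_one_right zero_le t.2.2)

/-- Only finitely many running maxima occur. Taking running maxima makes `stepFun` defined on the
whole product space, where continuous functions are measurable. -/
theorem continuous_stepFun (N : ℕ) : Continuous (stepFun N) := by
  rw [continuous_iff_continuousAt]
  intro v
  refine tendsto_of_tendstoUniformly ?_
  rw [Metric.tendstoUniformly_iff]
  intro ε hε
  have h : ∀ i ∈ Finset.range (N + 1), ∀ᶠ w in 𝓝 v,
      dist (partialSups v i) (partialSups w i) < ε := fun i _ => by
    have hc : Continuous fun w : ℕ → ℝ≥0 => partialSups w i :=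
      Continuous.partialSups_apply (f := fun k (w : ℕ → ℝ≥0) => w k) fun k _ => continuous_apply k
    filter_upwards [Metric.tendsto_nhds.1 (hc.tendsto v) ε hε] with w hw
    rwa [dist_comm]
  filter_upwards [(Finset.eventually_all _).2 h] with w hw t
  exact hw _ (Finset.mem_range.2 (Nat.lt_succ_of_le (floor_mul_le N t)))

/-- The step function interpolating `ξ` at the multiples of `1 / (n + 1)`. -/
def approx (n : ℕ) (ξ : DOne) : DOne :=
  stepFun (n + 1) fun i => ξ.extend ((i : ℝ≥0) / ((n : ℝ≥0) + 1))

theorem approx_apply (n : ℕ) (ξ : DOne) (t : UnitI) :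
    approx n ξ t = ξ.extend ((⌊((n + 1 : ℕ) : ℝ≥0) * t⌋₊ : ℝ≥0) / ((n : ℝ≥0) + 1)) := by
  have hm : Monotone fun i : ℕ => ξ.extend ((i : ℝ≥0) / ((n : ℝ≥0) + 1)) := fun i j hij =>
    ξ.extend.mono (by gcongr)
  simp only [approx, stepFun]
  rw [hm.partialSups_eq]

/-- The largest increment of `ξ` between consecutive multiples of `1 / (n + 1)`. -/
def maxIncr (n : ℕ) (ξ : DOne) : ℝ≥0 :=
  (Finset.range (n + 1 + 1)).sup' Finset.nonempty_range_add_one fun i =>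
    ξ.extend (((i + 1 : ℕ) : ℝ≥0) / ((n : ℝ≥0) + 1)) - ξ.extend ((i : ℝ≥0) / ((n : ℝ≥0) + 1))

theorem measurable_maxIncr (n : ℕ) : Measurable (maxIncr n) :=
  Finset.measurable_range_sup'' fun _ _ =>
    ((measurable_eval _).comp measurable_extend).sub ((measurable_eval _).comp measurable_extend)

theorem tendsto_approx {ξ : DOne} (h : Tendsto (fun n => maxIncr n ξ) atTop (𝓝 0)) :
    Tendsto (fun n => approx n ξ) atTop (𝓝 ξ) := by
  refine tendsto_of_tendstoUniformly ?_
  rw [Metric.tendstoUniformly_iff]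
  intro ε hε
  filter_upwards [(NNReal.tendsto_coe.2 h).eventually (gt_mem_nhds hε)] with n hn t
  refine lt_of_le_of_lt ?_ hn
  have hp : (0 : ℝ≥0) < (n : ℝ≥0) + 1 := by positivity
  set i := ⌊((n + 1 : ℕ) : ℝ≥0) * t⌋₊ with hi
  have h1 : approx n ξ t ≤ ξ t := by
    rw [approx_apply, ← extend_coe]
    refine ξ.extend.mono ?_
    rw [div_le_iff₀ hp, mul_comm]
    exact_mod_cast Nat.floor_le zero_le
  have h2 : ξ t ≤ ξ.extend (((i + 1 : ℕ) : ℝ≥0) / ((n : ℝ≥0) + 1)) := by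
    rw [← extend_coe]
    refine ξ.extend.mono ?_
    rw [le_div_iff₀ hp, mul_comm]
    exact_mod_cast (Nat.lt_floor_add_one (((n + 1 : ℕ) : ℝ≥0) * t)).le
  -- At `t = 1` the index `i` is `n + 1`, hence the `n + 2` indices in `maxIncr`; the increment
  -- there vanishes, as the extension is constant.
  have h3 : ξ.extend (((i + 1 : ℕ) : ℝ≥0) / ((n : ℝ≥0) + 1)) -
      ξ.extend ((i : ℝ≥0) / ((n : ℝ≥0) + 1)) ≤ maxIncr n ξ :=
    Finset.le_sup' (fun i : ℕ => ξ.extend (((i + 1 : ℕ) : ℝ≥0) / ((n : ℝ≥0) + 1)) -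
      ξ.extend ((i : ℝ≥0) / ((n : ℝ≥0) + 1)))
      (Finset.mem_range.2 (Nat.lt_succ_of_le (floor_mul_le (n + 1) t)))
  have h4 : ξ t ≤ maxIncr n ξ + approx n ξ t := by
    rw [approx_apply]
    exact h2.trans (tsub_le_iff_right.1 h3)
  have h4' : (ξ t : ℝ) ≤ maxIncr n ξ + approx n ξ t := by exact_mod_cast h4
  rw [NNReal.dist_eq, abs_of_nonneg (sub_nonneg.2 (NNReal.coe_le_coe.2 h1))]
  linarith

theorem tendsto_maxIncr {ξ : DOne} (hξ : Continuous ξ.toFun) :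
    Tendsto (fun n => maxIncr n ξ) atTop (𝓝 0) := by
  rw [← NNReal.tendsto_coe, NNReal.coe_zero, tendsto_order]
  refine ⟨fun b hb => Eventually.of_forall fun n => hb.trans_le (NNReal.coe_nonneg _),
    fun ε hε => ?_⟩
  obtain ⟨δ, hδ, hu⟩ := Metric.uniformContinuous_iff.1
    (CompactSpace.uniformContinuous_of_continuous hξ) ε hε
  filter_upwards [(tendsto_one_div_add_atTop_nhds_zero_nat (𝕜 := ℝ)).eventually
    (gt_mem_nhds hδ)] with n hn
  lift ε to ℝ≥0 using hε.le
  rw [NNReal.coe_lt_coe, maxIncr, Finset.sup'_lt_iff]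
  intro i _
  have hd : dist (ξ.extend (((i + 1 : ℕ) : ℝ≥0) / ((n : ℝ≥0) + 1)))
      (ξ.extend ((i : ℝ≥0) / ((n : ℝ≥0) + 1))) < ε := by
    refine hu (lt_of_le_of_lt ?_ hn)
    rw [Subtype.dist_eq, NNReal.dist_eq]
    simp only [NNReal.coe_min]
    refine (abs_inf_sub_inf_le_abs _ _ _).trans (le_of_eq ?_)
    push_cast
    rw [add_div, add_sub_cancel_left, abs_of_nonneg (by positivity)]
  rw [NNReal.dist_eq] at hd
  have := (le_abs_self _).trans_lt hd
  rw [← NNReal.coe_lt_coe, NNReal.coe_sub (ξ.extend.mono (by gcongr; simp))]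
  exact this

/-- A continuous function on `D_{↑,1}` has a measurable version. -/
theorem exists_measurable_eq (h : DOne →ᵇ ℝ) : ∃ h' : DOne → ℝ, Measurable h' ∧
    ∀ ξ, Tendsto (fun n => maxIncr n ξ) atTop (𝓝 0) → h' ξ = h ξ := by
  have hm : ∀ n, Measurable fun ξ => h (approx n ξ) := fun n => by
    have h1 : Measurable fun v : ℕ → ℝ≥0 => h (stepFun (n + 1) v) :=
      (h.continuous.comp (continuous_stepFun (n + 1))).measurable
    exact h1.comp (measurable_pi_lambda _ fun i => (measurable_eval _).comp measurable_extend)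
  refine ⟨fun ξ => limsup (fun n => h (approx n ξ)) atTop, Measurable.limsup hm, fun ξ hξ => ?_⟩
  exact ((h.continuous.tendsto ξ).comp (tendsto_approx hξ)).limsup_eq

/-! ### The tied-down measure -/

/-- The kernel `ξ ↦ dξ` on `[0,1]`. -/
def unitKernel : Kernel DInf ℝ≥0 where
  toFun ξ := ξ.measure.restrict (Icc 0 1)
  measurable' := by
    refine Measurable.measure_of_isPiSystem
      ((BorelSpace.measurable_eq (α := ℝ≥0)).trans (borel_eq_generateFrom_Iic ℝ≥0)) isPiSystem_Iic ?_ ?_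
    · rintro _ ⟨t, rfl⟩
      have : ∀ ξ : DInf, (ξ.measure.restrict (Icc 0 1)) (Iic t) = ξ (min t 1) := fun ξ => by
        rw [Measure.restrict_apply measurableSet_Iic, ← ξ.measure_Icc_zero]
        congr 1
        ext s
        simp
      simp only [this]
      exact measurable_coe_nnreal_ennreal.comp (measurable_eval _)
    · simp only [Measure.restrict_apply_univ, NonDec.measure_Icc_zero]
      exact measurable_coe_nnreal_ennreal.comp (measurable_eval _)

theorem unitKernel_apply (ξ : DInf) : unitKernel ξ = ξ.measure.restrict (Icc 0 1) := rfl

theorem unitKernel_apply_univ (ξ : DInf) : unitKernel ξ univ = ξ 1 := by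
  rw [unitKernel_apply, Measure.restrict_apply_univ, ξ.measure_Icc_zero]

/-- The total mass `ξ 1` is finite but not uniformly bounded, so the kernel is cut according to `⌊ξ
1⌋`. -/
instance : IsSFiniteKernel unitKernel := by
  classical
  have hs : ∀ n : ℕ, MeasurableSet {ξ : DInf | ⌊ξ 1⌋₊ = n} := fun n =>
    (Nat.measurable_floor.comp (measurable_eval (1 : ℝ≥0))) (measurableSet_singleton n)
  have hfin : ∀ n, IsFiniteKernel (Kernel.piecewise (hs n) unitKernel 0) := fun n => by
    refine ⟨⟨(n + 1 : ℕ), ENNReal.natCast_lt_top _, fun ξ => ?_⟩⟩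
    rw [Kernel.piecewise_apply]
    split_ifs with h
    · rw [unitKernel_apply_univ]
      have h1 : ξ 1 < (⌊ξ 1⌋₊ : ℝ≥0) + 1 := Nat.lt_floor_add_one _
      rw [show ⌊ξ 1⌋₊ = n from h] at h1
      exact_mod_cast h1.le
    · simp
  have heq : unitKernel = Kernel.sum fun n => Kernel.piecewise (hs n) unitKernel 0 := by
    ext ξ s hs'
    rw [Kernel.sum_apply' _ _ hs', tsum_eq_single ⌊ξ 1⌋₊]
    · rw [Kernel.piecewise_apply, if_pos (by simp)]
    · intro n hn
      rw [Kernel.piecewise_apply, if_neg (show ξ ∉ {ξ : DInf | ⌊ξ 1⌋₊ = n} from fun h => hn (Eq.symm h))]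
      simp
  rw [heq]
  exact Kernel.isSFiniteKernel_sum

section TiedDownMeasure

variable {Ω : Type*} [MeasurableSpace Ω] {P : Measure Ω} [IsProbabilityMeasure P] {M : Ω → DInf}

/-- The measure `S ↦ E ∫₀¹ 1_S (Δ_{t,γ} M) dM(t)`. -/
def tiedDownMeasure (γ : ℝ) (P : Measure Ω) {M : Ω → DInf} (hM : Measurable M) : Measure DOne :=
  (P ⊗ₘ (unitKernel.comap M hM)).map fun p => ((M p.1).dilate γ p.2).toOne

theorem measurable_dilate_comp (γ : ℝ) (hM : Measurable M) :
    Measurable fun p : Ω × ℝ≥0 => ((M p.1).dilate γ p.2).toOne :=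
  (measurable_dilate_toOne γ).comp ((hM.comp measurable_fst).prodMk measurable_snd)

theorem tiedDownMeasure_univ (γ : ℝ) (hM : Measurable M) :
    tiedDownMeasure γ P hM univ = ∫⁻ ω, M ω 1 ∂P := by
  rw [tiedDownMeasure, Measure.map_apply (measurable_dilate_comp γ hM) MeasurableSet.univ,
    preimage_univ, Measure.compProd_apply MeasurableSet.univ]
  simp only [preimage_univ, Kernel.comap_apply, unitKernel_apply_univ]

theorem integral_tiedDownMeasure (γ : ℝ) (hM : Measurable M)
    [IsFiniteMeasure (tiedDownMeasure γ P hM)] {φ : DOne → ℝ} (hφ : Measurable φ) {C : ℝ}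
    (hC : ∀ ξ, |φ ξ| ≤ C) : ∫ ξ, φ ξ ∂(tiedDownMeasure γ P hM) =
      ∫ ω, ∫ t in Icc 0 1, φ ((M ω).dilate γ t).toOne ∂(M ω).measure ∂P := by
  have hm := measurable_dilate_comp γ hM
  have hInt : Integrable φ (tiedDownMeasure γ P hM) :=
    (integrable_const C).mono' hφ.aestronglyMeasurable (ae_of_all _ hC)
  rw [tiedDownMeasure, integral_map hm.aemeasurable hφ.aestronglyMeasurable,
    Measure.integral_compProd]
  · simp only [Kernel.comap_apply, unitKernel_apply]
  · exact (integrable_map_measure hφ.aestronglyMeasurable hm.aemeasurable).1 hInt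

theorem stronglyMeasurable_setIntegral_dilate (γ : ℝ) (hM : Measurable M) {φ : DOne → ℝ}
    (hφ : Measurable φ) : StronglyMeasurable fun ω =>
      ∫ t in Icc 0 1, φ ((M ω).dilate γ t).toOne ∂(M ω).measure :=
  StronglyMeasurable.integral_kernel_prod_right' (κ := unitKernel.comap M hM)
    (f := fun p => φ ((M p.1).dilate γ p.2).toOne)
    (hφ.comp (measurable_dilate_comp γ hM)).stronglyMeasurable

/-- A `J₁`-continuous `h` is not known to be measurable, so Fubini is applied to a measurable
version. The two agree on paths with vanishing `maxIncr`, a measurable set carrying the whole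
measure because dilations of continuous paths are continuous. -/
theorem isTiedDownLaw_tiedDownMeasure (γ : ℝ) (hM : Measurable M)
    (hMcont : ∀ᵐ ω ∂P, Continuous (M ω).toFun) [IsProbabilityMeasure (tiedDownMeasure γ P hM)] :
    IsTiedDownLaw γ P M ⟨tiedDownMeasure γ P hM, inferInstance⟩ := by
  intro h
  obtain ⟨h₁, hm₁, heq₁⟩ := exists_measurable_eq h
  set h' : DOne → ℝ := fun ξ => max (-‖h‖) (min ‖h‖ (h₁ ξ)) with hh'
  have hm : Measurable h' := measurable_const.max (measurable_const.min hm₁)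
  have heq : ∀ ξ, Tendsto (fun n => maxIncr n ξ) atTop (𝓝 0) → h' ξ = h ξ := fun ξ hξ => by
    have := abs_le.1 (h.norm_coe_le_norm ξ)
    simp only [hh', heq₁ ξ hξ]
    rw [min_eq_right this.2, max_eq_right this.1]
  have hset : MeasurableSet {ξ : DOne | Tendsto (fun n => maxIncr n ξ) atTop (𝓝 0)} :=
    measurableSet_tendsto _ measurable_maxIncr
  have hae : ∀ᵐ ξ ∂(tiedDownMeasure γ P hM), Tendsto (fun n => maxIncr n ξ) atTop (𝓝 0) := by
    have hmd := measurable_dilate_comp γ hM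
    rw [tiedDownMeasure]
    refine (ae_map_iff hmd.aemeasurable hset).2 ((Measure.ae_compProd_iff (hmd hset)).2 ?_)
    filter_upwards [hMcont] with ω hω
    exact ae_of_all _ fun t => tendsto_maxIncr (continuous_dilate_toOne hω γ t)
  calc ∫ ξ, h ξ ∂(tiedDownMeasure γ P hM) = ∫ ξ, h' ξ ∂(tiedDownMeasure γ P hM) :=
        integral_congr_ae (hae.mono fun ξ hξ => (heq ξ hξ).symm)
    _ = ∫ ω, ∫ t in Icc 0 1, h' ((M ω).dilate γ t).toOne ∂(M ω).measure ∂P :=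
        integral_tiedDownMeasure γ hM hm fun ξ => abs_clamp_le _ _ (norm_nonneg h)
    _ = _ := by
        refine integral_congr_ae ?_
        filter_upwards [hMcont] with ω hω
        refine integral_congr_ae (ae_of_all _ fun t => ?_)
        exact heq _ (tendsto_maxIncr (continuous_dilate_toOne hω γ t))

end TiedDownMeasure

/-! ### Uniform integrability of the occupation times -/

section Occupation

variable {X : Type*} {T : X → X} {a : ℕ → ℝ≥0}

/-- The normalized occupation time of `B`. -/
def occ (T : X → X) (a : ℕ → ℝ≥0) (B : Set X) (n : ℕ) (x : X) : ℝ :=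
  ∑ k ∈ Finset.range n, B.indicator (1 : X → ℝ) (T^[k] x) / a n

theorem indicator_div_nonneg (B : Set X) (n : ℕ) (x : X) :
    0 ≤ B.indicator (1 : X → ℝ) x / a n :=
  div_nonneg (indicator_nonneg (fun _ _ => zero_le_one) _) (NNReal.coe_nonneg _)

theorem indicator_div_le (B : Set X) (n : ℕ) (x : X) :
    B.indicator (1 : X → ℝ) x / a n ≤ 1 / a n :=
  div_le_div_of_nonneg_right (indicator_le_self' (fun _ _ => zero_le_one) _) (NNReal.coe_nonneg _)

theorem occ_nonneg (B : Set X) (n : ℕ) (x : X) : 0 ≤ occ T a B n x :=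
  Finset.sum_nonneg fun _ _ => indicator_div_nonneg B n _

theorem occ_le (B : Set X) (n : ℕ) (x : X) : occ T a B n x ≤ n / a n := by
  refine (Finset.sum_le_card_nsmul _ _ _ fun k _ => indicator_div_le B n _).trans (le_of_eq ?_)
  simp [div_eq_mul_inv]

end Occupation

section UniformIntegrability

variable {X : Type*} [MeasurableSpace X] {m : Measure X} {T : X → X} {a : ℕ → ℝ≥0}
  {R : Set (Set X)}

/-- The mean of the normalized occupation time of `B` over `C`. -/
def meanOcc (m : Measure X) (T : X → X) (a : ℕ → ℝ≥0) (B : Set X) (n : ℕ) (C : Set X) : ℝ :=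
  1 / (a n : ℝ) * ∑ k ∈ Finset.range n, m.real (C ∩ T^[k] ⁻¹' B)

theorem meanOcc_mono {B C C' : Set X} (hC' : m C' ≠ ∞) (h : C ⊆ C') (n : ℕ) :
    meanOcc m T a B n C ≤ meanOcc m T a B n C' := by
  unfold meanOcc
  gcongr with k _
  · exact ne_top_of_le_ne_top hC' (measure_mono inter_subset_left)

theorem meanOcc_le {B C : Set X} (hC : m C ≠ ∞) (n : ℕ) :
    meanOcc m T a B n C ≤ n / a n * m.real C := by
  have h : ∑ k ∈ Finset.range n, m.real (C ∩ T^[k] ⁻¹' B) ≤ n * m.real C := by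
    refine (Finset.sum_le_card_nsmul _ _ (m.real C) fun k _ =>
      measureReal_mono inter_subset_left hC).trans (le_of_eq ?_)
    simp
  calc meanOcc m T a B n C ≤ 1 / (a n : ℝ) * (n * m.real C) := by unfold meanOcc; gcongr
    _ = _ := by ring

/-- The means of the occupation times over subsets of `A` are uniformly absolutely continuous. -/
theorem IsWeaklyRationallyErgodic.exists_meanOcc_le (hT : IsWeaklyRationallyErgodic m T a R)
    {A B : Set X} (hA : A ∈ R) (hB : B ∈ R) {ε : ℝ} (hε : 0 < ε) :
    ∃ δ : ℝ≥0∞, 0 < δ ∧ ∀ n, ∀ C, MeasurableSet C → C ⊆ A → m C < δ →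
      meanOcc m T a B n C ≤ ε := by
  by_contra! hcon
  have hAtop : m A ≠ ∞ := (hT.measure_lt_top A hA).ne
  obtain ⟨η, hη, hηB⟩ : ∃ η : ℝ, 0 < η ∧ η * m.real B < ε := by
    refine ⟨ε / (m.real B + 1), by positivity, ?_⟩
    rw [div_mul_eq_mul_div, div_lt_iff₀ (by positivity)]
    nlinarith
  obtain ⟨e, he, hesum⟩ := ENNReal.exists_pos_sum_of_countable'
    (ENNReal.ofReal_pos.2 hη).ne' ℕ
  -- For each of the finitely many `n < k` the mean over `C` is at most `(n / a n) * m C`, so a bad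
  -- set of small enough measure can only occur at some `n ≥ k`.
  have hd : ∀ k : ℕ, ∃ n, k ≤ n ∧ ∃ C, MeasurableSet C ∧ C ⊆ A ∧ m C < e k ∧
      ε < meanOcc m T a B n C := by
    intro k
    set D : ℝ := 1 + ∑ n ∈ Finset.range k, (n : ℝ) / a n with hD
    have hD0 : 0 < D := by positivity
    obtain ⟨n, C, hCm, hCA, hCd, hCε⟩ := hcon (min (e k) (ENNReal.ofReal (ε / D)))
      (lt_min (he k) (ENNReal.ofReal_pos.2 (by positivity)))
    rw [lt_min_iff] at hCd
    refine ⟨n, not_lt.1 fun hnk => ?_, C, hCm, hCA, hCd.1, hCε⟩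
    have hCtop : m C ≠ ∞ := ne_top_of_le_ne_top hAtop (measure_mono hCA)
    have h1 : m.real C ≤ ε / D := ENNReal.toReal_le_of_le_ofReal (by positivity) hCd.2.le
    have h2 : (n : ℝ) / a n ≤ D := by
      have := Finset.single_le_sum (f := fun n : ℕ => (n : ℝ) / a n) (fun i _ => by positivity)
        (Finset.mem_range.2 hnk)
      linarith
    have h3 : meanOcc m T a B n C ≤ D * (ε / D) := (meanOcc_le hCtop n).trans (by gcongr)
    rw [mul_div_cancel₀ _ hD0.ne'] at h3
    exact absurd hCε (not_lt.2 h3)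
  choose n hn C hCm hCA hCe hCε using hd
  -- By heredity `U` is in the ring, so its means converge to `m U * m B < ε`, yet along `n N` they
  -- dominate those of the bad sets.
  set U : Set X := ⋃ k, C k with hU
  have hUm : MeasurableSet U := MeasurableSet.iUnion hCm
  have hUA : U ⊆ A := iUnion_subset hCA
  have hUR : U ∈ R := hT.hereditary A hA U hUm hUA
  have hUtop : m U ≠ ∞ := (hT.measure_lt_top U hUR).ne
  have hUη : m.real U ≤ η := by
    refine ENNReal.toReal_le_of_le_ofReal hη.le ?_
    exact ((measure_iUnion_le C).trans (ENNReal.tsum_le_tsum fun k => (hCe k).le)).trans hesum.le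
  have hlt : m.real U * m.real B < ε := lt_of_le_of_lt (by gcongr) hηB
  obtain ⟨N, hN⟩ := eventually_atTop.1 ((hT.tendsto U hUR B hB).eventually (gt_mem_nhds hlt))
  have h1 := hN (n N) (hn N)
  have h2 := (hCε N).trans_le (meanOcc_mono (a := a) (T := T) (B := B) hUtop
    (subset_iUnion C N) (n N))
  exact absurd h1 (not_lt.2 h2.le)

theorem measurable_occ (hT : Measurable T) {B : Set X} (hB : MeasurableSet B) (n : ℕ) :
    Measurable (occ T a B n) :=
  Finset.measurable_fun_sum _ fun k _ =>
    ((measurable_one.indicator hB).comp (hT.iterate k)).div_const _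

theorem integrableOn_occ (hT : Measurable T) {B : Set X} (hB : MeasurableSet B) (n : ℕ) {C : Set X}
    (hC : m C ≠ ∞) : IntegrableOn (occ T a B n) C m := by
  refine Measure.integrableOn_of_bounded (M := n / a n) hC
    (measurable_occ hT hB n).aestronglyMeasurable (ae_of_all _ fun x => ?_)
  rw [Real.norm_eq_abs, abs_of_nonneg (occ_nonneg _ _ _)]
  exact occ_le _ _ _

theorem setIntegral_occ (hT : Measurable T) {B : Set X} (hB : MeasurableSet B) (n : ℕ) {C : Set X}
    (hC : m C ≠ ∞) : ∫ x in C, occ T a B n x ∂m = meanOcc m T a B n C := by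
  unfold occ meanOcc
  rw [integral_finsetSum, Finset.mul_sum]
  · refine Finset.sum_congr rfl fun k _ => ?_
    have hk : MeasurableSet (T^[k] ⁻¹' B) := hT.iterate k hB
    have : ∀ x, B.indicator (1 : X → ℝ) (T^[k] x) / a n =
        (T^[k] ⁻¹' B).indicator (fun _ => 1 / (a n : ℝ)) x := fun x => by
      by_cases hx : T^[k] x ∈ B
      · rw [indicator_of_mem hx, indicator_of_mem (show x ∈ T^[k] ⁻¹' B from hx), Pi.one_apply]
      · rw [indicator_of_notMem hx, indicator_of_notMem (show x ∉ T^[k] ⁻¹' B from hx), zero_div]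
    simp only [this]
    rw [setIntegral_indicator hk, setIntegral_const, smul_eq_mul, mul_comm]
  · intro k _
    refine Measure.integrableOn_of_bounded (M := 1 / a n) hC
      (((measurable_one.indicator hB).comp (hT.iterate k)).div_const _).aestronglyMeasurable
      (ae_of_all _ fun x => ?_)
    rw [Real.norm_eq_abs, abs_of_nonneg (indicator_div_nonneg B n _)]
    exact indicator_div_le B n _

/-- The means over `A` are bounded by some `V`, so Markov's inequality makes `{occ ≥ K}` small in
`A`, and uniform absolute continuity bounds the mean over that set. -/
theorem IsWeaklyRationallyErgodic.exists_integral_occ_tail_le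
    (hT : IsWeaklyRationallyErgodic m T a R) {A B : Set X} (hA : A ∈ R) (hB : B ∈ R) {ε : ℝ}
    (hε : 0 < ε) : ∃ K : ℝ, 0 ≤ K ∧ ∀ n, ∫ x in A, max (occ T a B n x - K) 0 ∂m ≤ ε := by
  have hTm := hT.measurePreserving.measurable
  have hBm := hT.measurableSet B hB
  have hAm := hT.measurableSet A hA
  have hAtop : m A ≠ ∞ := (hT.measure_lt_top A hA).ne
  obtain ⟨δ, hδ, h⟩ := hT.exists_meanOcc_le hA hB hε
  obtain ⟨V, hV⟩ := (hT.tendsto A hA B hB).bddAbove_range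
  have hV' : ∀ n, meanOcc m T a B n A ≤ V := fun n => hV ⟨n, rfl⟩
  have hV0 : 0 ≤ V := by simpa [meanOcc] using hV' 0
  obtain ⟨δ', hδ', hδδ'⟩ := ENNReal.lt_iff_exists_real_btwn.1 hδ
  have hδ'0 : 0 < δ' := ENNReal.ofReal_pos.1 hδδ'.1
  set K : ℝ := (V + 1) / δ' with hK
  have hK0 : 0 < K := by positivity
  refine ⟨K, hK0.le, fun n => ?_⟩
  set D : Set X := A ∩ {x | K ≤ occ T a B n x} with hD
  have hDm' : MeasurableSet {x | K ≤ occ T a B n x} :=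
    measurableSet_le measurable_const (measurable_occ hTm hBm n)
  have hDm : MeasurableSet D := hAm.inter hDm'
  have hDA : D ⊆ A := inter_subset_left
  have hDtop : m D ≠ ∞ := ne_top_of_le_ne_top hAtop (measure_mono hDA)
  have hInt := integrableOn_occ (a := a) hTm hBm n hAtop
  have hDδ : m D < δ := by
    have h1 : K * m.real D ≤ V := by
      have h2 := mul_meas_ge_le_integral_of_nonneg (μ := m.restrict A)
        (ae_of_all _ fun x => occ_nonneg (T := T) (a := a) B n x) hInt K
      rw [setIntegral_occ hTm hBm n hAtop, measureReal_restrict_apply hDm', inter_comm] at h2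
      exact h2.trans (hV' n)
    have h3 : m.real D ≤ δ' := by
      rw [hK, div_mul_eq_mul_div, div_le_iff₀ hδ'0] at h1
      have h4 : 0 ≤ m.real D := measureReal_nonneg
      by_contra! hlt
      nlinarith
    refine lt_of_le_of_lt ?_ hδδ'.2
    rw [← ENNReal.ofReal_toReal hDtop]
    exact ENNReal.ofReal_le_ofReal h3
  calc ∫ x in A, max (occ T a B n x - K) 0 ∂m
      ≤ ∫ x in A, {x | K ≤ occ T a B n x}.indicator (occ T a B n) x ∂m := by
        refine integral_mono ?_ (hInt.indicator hDm') fun x => ?_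
        · exact (hInt.sub (integrableOn_const hAtop)).pos_part
        · by_cases hx : K ≤ occ T a B n x
          · rw [indicator_of_mem (show x ∈ {x | K ≤ occ T a B n x} from hx)]
            exact max_le (by linarith) (occ_nonneg _ _ _)
          · rw [indicator_of_notMem (show x ∉ {x | K ≤ occ T a B n x} from hx)]
            exact max_le (by linarith [not_le.1 hx]) le_rfl
    _ = meanOcc m T a B n D := by
        rw [setIntegral_indicator hDm', ← setIntegral_occ hTm hBm n hDtop]
    _ ≤ ε := h n D hDm hDA hDδ

end UniformIntegrability

open scoped PiCountable

/-! ### Joint convergence of occupation times -/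

theorem measurable_Psi {X : Type*} [MeasurableSpace X] {T : X → X} {a : ℕ → ℝ≥0} {f : X → ℝ≥0}
    (hT : Measurable T) (hf : Measurable f) (n : ℕ) : Measurable (Psi T a f n) :=
  measurable_of_eval fun _ =>
    (Finset.measurable_fun_sum _ fun k _ => hf.comp (hT.iterate k)).div_const _

theorem Psi_const_mul {X : Type*} (T : X → X) (a : ℕ → ℝ≥0) (f : X → ℝ≥0) (c : ℝ≥0) (n : ℕ)
    (x : X) : Psi T a (fun y => c * f y) n x = (Psi T a f n x).scale c := by
  ext t
  simp [Psi, NonDec.scale, birkhoffSum, ← Finset.mul_sum, mul_div_assoc]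

theorem lap_Psi_add {X : Type*} (T : X → X) (a : ℕ → ℝ≥0) (f f' : X → ℝ≥0) (n : ℕ) (x : X)
    (p : ℕ × ℕ) :
    lap (Psi T a (fun y => f y + f' y) n x) p = lap (Psi T a f n x) p * lap (Psi T a f' n x) p := by
  have h : cumul (Psi T a (fun y => f y + f' y) n x) (ratPt p) =
      cumul (Psi T a f n x) (ratPt p) + cumul (Psi T a f' n x) (ratPt p) := by
    unfold cumul
    rw [← intervalIntegral.integral_add (NonDec.monotone_real _).intervalIntegrable
      (NonDec.monotone_real _).intervalIntegrable]
    congr 1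
    ext s
    simp [Psi, birkhoffSum, Finset.sum_add_distrib, add_div]
  rw [lap, lap, lap, h, neg_add, Real.exp_add]

theorem coe_indicator_one {X : Type*} (B : Set X) (x : X) :
    ((B.indicator (1 : X → ℝ≥0) x : ℝ≥0) : ℝ≥0∞) = B.indicator 1 x := by
  by_cases hx : x ∈ B <;> simp [hx]

section Integ

variable {X : Type*} [MeasurableSpace X] {m : Measure X} {f f' : X → ℝ≥0}

theorem IsL1Pos.add (hf : IsL1Pos m f) (hf' : IsL1Pos m f') : IsL1Pos m fun x => f x + f' x := by
  refine ⟨hf.1.add hf'.1, ?_⟩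
  simp only [ENNReal.coe_add]
  rw [lintegral_add_left hf.1.coe_nnreal_ennreal]
  exact ENNReal.add_lt_top.2 ⟨hf.2, hf'.2⟩

theorem IsL1Pos.const_mul (hf : IsL1Pos m f) (c : ℝ≥0) : IsL1Pos m fun x => c * f x := by
  refine ⟨hf.1.const_mul c, ?_⟩
  simp only [ENNReal.coe_mul]
  rw [lintegral_const_mul _ hf.1.coe_nnreal_ennreal]
  exact ENNReal.mul_lt_top ENNReal.coe_lt_top hf.2

theorem integ_add (hf : IsL1Pos m f) (hf' : IsL1Pos m f') :
    integ m (fun x => f x + f' x) = integ m f + integ m f' := by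
  simp only [integ, ENNReal.coe_add]
  rw [lintegral_add_left hf.1.coe_nnreal_ennreal, ENNReal.toNNReal_add hf.2.ne hf'.2.ne]

theorem integ_const_mul (hf : IsL1Pos m f) (c : ℝ≥0) :
    integ m (fun x => c * f x) = c * integ m f := by
  simp only [integ, ENNReal.coe_mul]
  rw [lintegral_const_mul _ hf.1.coe_nnreal_ennreal, ENNReal.toNNReal_mul, ENNReal.toNNReal_coe]

theorem isL1Pos_indicator {B : Set X} (hB : MeasurableSet B) (h : m B < ∞) :
    IsL1Pos m (B.indicator 1) := by
  refine ⟨measurable_one.indicator hB, ?_⟩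
  simpa only [coe_indicator_one, lintegral_indicator_one hB] using h

theorem integ_indicator {B : Set X} (hB : MeasurableSet B) :
    integ m (B.indicator 1) = (m B).toNNReal := by
  simp only [integ, coe_indicator_one, lintegral_indicator_one hB]

end Integ

section Joint

variable {X Ω : Type*} [MeasurableSpace X] [MeasurableSpace Ω] {m Q : Measure X}
  [IsProbabilityMeasure Q] {P : Measure Ω} {T : X → X} {a : ℕ → ℝ≥0} {f f' f₀ : X → ℝ≥0}
  {M : Ω → DInf}

theorem integrable_of_lap {u : X → ℝ} (hu : Measurable u) (h : ∀ x, u x ∈ Icc (0 : ℝ) 1) :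
    Integrable u Q :=
  (integrable_const (1 : ℝ)).mono' hu.aestronglyMeasurable
    (ae_of_all _ fun x => by rw [Real.norm_eq_abs, abs_of_nonneg (h x).1]; exact (h x).2)

theorem tendsto_integral_lap (hQ : Q ≪ m)
    (hconv : StrongDistConv m (Psi T a f) P (fun ω => (M ω).scale (integ m f))) (p : ℕ × ℕ) :
    Tendsto (fun n => ∫ x, lap (Psi T a f n x) p ∂Q) atTop
      (𝓝 (∫ ω, lap ((M ω).scale (integ m f)) p ∂P)) :=
  hconv Q inferInstance hQ (BoundedContinuousFunction.ofNormedAddCommGroup (fun ξ => lap ξ p)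
    ((continuous_apply p).comp continuous_lap) 1 fun ξ => by
      rw [Real.norm_eq_abs, abs_of_nonneg (lap_mem_Icc ξ p).1]
      exact (lap_mem_Icc ξ p).2)

/-- Occupation times of functions with equal integrals are asymptotically equal in measure. -/
theorem tendsto_integral_sq_lap_sub (hQ : Q ≪ m) (hT : Measurable T)
    (hconv : ∀ f : X → ℝ≥0, IsL1Pos m f →
      StrongDistConv m (Psi T a f) P (fun ω => (M ω).scale (integ m f)))
    (hf : IsL1Pos m f) (hf' : IsL1Pos m f') (h : integ m f = integ m f') (p : ℕ × ℕ) :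
    Tendsto (fun n => ∫ x, (lap (Psi T a f n x) p - lap (Psi T a f' n x) p) ^ 2 ∂Q) atTop
      (𝓝 0) := by
  -- Laplace coordinates turn sums of functions into products, so the hypothesis for `g + g'` gives
  -- all three terms of the expanded square the same limit.
  have key : ∀ {g g' : X → ℝ≥0}, IsL1Pos m g → IsL1Pos m g' → integ m g = integ m f →
      integ m g' = integ m f →
      Tendsto (fun n => ∫ x, lap (Psi T a g n x) p * lap (Psi T a g' n x) p ∂Q) atTop
        (𝓝 (∫ ω, lap ((M ω).scale (integ m f + integ m f)) p ∂P)) := by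
    intro g g' hg hg' hgf hgf'
    have := tendsto_integral_lap hQ (hconv _ (hg.add hg')) p
    simpa only [lap_Psi_add, integ_add hg hg', hgf, hgf'] using this
  have h1 := ((key hf hf rfl rfl).sub ((key hf hf' rfl h.symm).const_mul 2)).add
    (key hf' hf' h.symm h.symm)
  rw [show ∀ I : ℝ, I - 2 * I + I = 0 by intro I; ring] at h1
  refine h1.congr fun n => ?_
  have hm : ∀ g, IsL1Pos m g → Measurable fun x => lap (Psi T a g n x) p := fun g hg =>
    (measurable_pi_iff.1 measurable_lap p).comp (measurable_Psi hT hg.1 n)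
  have hi : ∀ g g', IsL1Pos m g → IsL1Pos m g' →
      Integrable (fun x => lap (Psi T a g n x) p * lap (Psi T a g' n x) p) Q := fun g g' hg hg' =>
    integrable_of_lap ((hm g hg).mul (hm g' hg')) fun x =>
      ⟨mul_nonneg (lap_mem_Icc _ _).1 (lap_mem_Icc _ _).1,
        mul_le_one₀ (lap_mem_Icc _ _).2 (lap_mem_Icc _ _).1 (lap_mem_Icc _ _).2⟩
  rw [← integral_const_mul, ← integral_sub (hi f f hf hf) ((hi f f' hf hf').const_mul 2),
    ← integral_add (f := fun x => lap (Psi T a f n x) p * lap (Psi T a f n x) p -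
      2 * (lap (Psi T a f n x) p * lap (Psi T a f' n x) p))
      ((hi f f hf hf).sub ((hi f f' hf hf').const_mul 2)) (hi f' f' hf' hf')]
  refine integral_congr_ae (ae_of_all _ fun x => ?_)
  simp only
  ring

/-- Rests on `|u| ≤ ε / 4 + u ^ 2 / ε`, a completed square. -/
theorem tendsto_integral_abs_of_sq {u : ℕ → X → ℝ} (hu : ∀ n, Measurable (u n))
    (hb : ∀ n x, |u n x| ≤ 1) (h : Tendsto (fun n => ∫ x, u n x ^ 2 ∂Q) atTop (𝓝 0)) :
    Tendsto (fun n => ∫ x, |u n x| ∂Q) atTop (𝓝 0) := by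
  rw [tendsto_order]
  refine ⟨fun b hb => Eventually.of_forall fun n =>
    hb.trans_le (integral_nonneg fun x => abs_nonneg _), fun ε hε => ?_⟩
  filter_upwards [h.eventually (gt_mem_nhds (by positivity : 0 < (ε / 2) ^ 2))] with n hn
  have hsq : Integrable (fun x => u n x ^ 2) Q :=
    (integrable_const (1 : ℝ)).mono' ((hu n).pow_const 2).aestronglyMeasurable
      (ae_of_all _ fun x => by
        rw [Real.norm_eq_abs, abs_of_nonneg (sq_nonneg _), ← sq_abs]
        exact pow_le_one₀ (abs_nonneg _) (hb n x))
  have h1 : ∫ x, |u n x| ∂Q ≤ ∫ x, (ε / 4 + u n x ^ 2 / ε) ∂Q := by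
    refine integral_mono_of_nonneg (ae_of_all _ fun x => abs_nonneg _)
      ((integrable_const _).add (hsq.div_const ε)) (ae_of_all _ fun x => ?_)
    have h2 : 0 ≤ (|u n x| - ε / 2) ^ 2 := sq_nonneg _
    rw [← sub_nonneg]
    have h3 : ε / 4 + u n x ^ 2 / ε - |u n x| = (|u n x| - ε / 2) ^ 2 / ε := by
      rw [← sq_abs (u n x)]
      field_simp
      ring
    simp only [h3]
    positivity
  rw [integral_add (integrable_const _) (hsq.div_const ε)] at h1
  simp only [integral_div, integral_const, probReal_univ, smul_eq_mul, one_mul] at h1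
  have h4 : (∫ x, u n x ^ 2 ∂Q) / ε < ε / 4 := by
    rw [div_lt_iff₀ hε]
    nlinarith
  linarith

/-- The metric of the countable product is a sum of coordinate distances capped by a summable
sequence, so convergence in each coordinate suffices by dominated convergence. -/
theorem tendsto_integral_dist_lap (hQ : Q ≪ m) (hT : Measurable T)
    (hconv : ∀ f : X → ℝ≥0, IsL1Pos m f →
      StrongDistConv m (Psi T a f) P (fun ω => (M ω).scale (integ m f)))
    (hf : IsL1Pos m f) (hf' : IsL1Pos m f') (h : integ m f = integ m f') :
    Tendsto (fun n => ∫ x, dist (lap (Psi T a f n x)) (lap (Psi T a f' n x)) ∂Q) atTop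
      (𝓝 0) := by
  set d : ℕ → ℕ × ℕ → X → ℝ := fun n p x =>
    min (2⁻¹ ^ Encodable.encode p) (dist (lap (Psi T a f n x) p) (lap (Psi T a f' n x) p)) with hd
  have hm : ∀ g, IsL1Pos m g → ∀ n p, Measurable fun x => lap (Psi T a g n x) p := fun g hg n p =>
    (measurable_pi_iff.1 measurable_lap p).comp (measurable_Psi hT hg.1 n)
  have hd0 : ∀ n p x, 0 ≤ d n p x := fun n p x => le_min (by positivity) dist_nonneg
  have hd1 : ∀ n p x, d n p x ≤ 2⁻¹ ^ Encodable.encode p := fun n p x => min_le_left _ _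
  have hdm : ∀ n p, Measurable (d n p) := fun n p =>
    measurable_const.min ((hm f hf n p).dist (hm f' hf' n p))
  have hdi : ∀ n p, Integrable (d n p) Q := fun n p =>
    (integrable_const ((2⁻¹ : ℝ) ^ Encodable.encode p)).mono' (hdm n p).aestronglyMeasurable
      (ae_of_all _ fun x => by rw [Real.norm_eq_abs, abs_of_nonneg (hd0 n p x)]; exact hd1 n p x)
  have hsum : Summable fun p : ℕ × ℕ => (2⁻¹ : ℝ) ^ Encodable.encode p := by
    simpa using summable_geometric_two_encode (ι := ℕ × ℕ)
  have hle : ∀ n p, ∫ x, d n p x ∂Q ≤ 2⁻¹ ^ Encodable.encode p := fun n p =>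
    (integral_mono (hdi n p) (integrable_const _) (hd1 n p)).trans (by simp)
  have heq : ∀ n, ∫ x, dist (lap (Psi T a f n x)) (lap (Psi T a f' n x)) ∂Q =
      ∑' p, ∫ x, d n p x ∂Q := fun n => by
    rw [integral_tsum_of_summable_integral_norm (hdi n)]
    · rfl
    · refine Summable.of_nonneg_of_le (fun p => integral_nonneg fun x => norm_nonneg _)
        (fun p => ?_) hsum
      simp only [Real.norm_eq_abs, abs_of_nonneg (hd0 n p _)]
      exact hle n p
  simp only [heq]
  rw [← tsum_zero (α := ℝ) (β := ℕ × ℕ)]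
  refine tendsto_tsum_of_dominated_convergence hsum (fun p => ?_)
    (Eventually.of_forall fun n p => ?_)
  · have habs := tendsto_integral_abs_of_sq (Q := Q)
      (u := fun n x => lap (Psi T a f n x) p - lap (Psi T a f' n x) p)
      (fun n => (hm f hf n p).sub (hm f' hf' n p))
      (fun n x => abs_sub_le_of_le_of_le (lap_mem_Icc _ _).1 (lap_mem_Icc _ _).2
        (lap_mem_Icc _ _).1 (lap_mem_Icc _ _).2 |>.trans (by simp))
      (tendsto_integral_sq_lap_sub hQ hT hconv hf hf' h p)
    refine squeeze_zero (fun n => integral_nonneg (hd0 n p)) (fun n => ?_) habs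
    refine integral_mono_of_nonneg (ae_of_all _ (hd0 n p)) ?_ (ae_of_all _ fun x => min_le_right _ _)
    refine (integrable_const (1 : ℝ)).mono'
      ((hm f hf n p).sub (hm f' hf' n p)).abs.aestronglyMeasurable (ae_of_all _ fun x => ?_)
    rw [Real.norm_eq_abs, abs_abs]
    exact abs_sub_le_of_le_of_le (lap_mem_Icc _ _).1 (lap_mem_Icc _ _).2
        (lap_mem_Icc _ _).1 (lap_mem_Icc _ _).2 |>.trans (by simp)
  · rw [Real.norm_eq_abs, abs_of_nonneg (integral_nonneg (hd0 n p))]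
    exact hle n p

theorem continuous_lap_scale (c : ℝ≥0) : Continuous fun ξ : DInf => lap (ξ.scale c) :=
  continuous_pi fun p => by
    simp only [lap, cumul_scale]
    exact Real.continuous_exp.comp ((continuous_cumul (ratPt p)).const_mul _).neg

/-- The pairs of occupation times of two functions converge jointly. -/
theorem tendsto_integral_lap_pair (hQ : Q ≪ m) (hT : Measurable T)
    (hconv : ∀ f : X → ℝ≥0, IsL1Pos m f →
      StrongDistConv m (Psi T a f) P (fun ω => (M ω).scale (integ m f)))
    (hf : IsL1Pos m f) (hf' : IsL1Pos m f') (hf₀ : IsL1Pos m f₀) (h₀ : integ m f₀ = 1)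
    (F : (ℕ × ℕ → ℝ) × (ℕ × ℕ → ℝ) → ℝ) (hF : ∃ K, LipschitzWith K F) (hFb : ∃ C, ∀ y, |F y| ≤ C) :
    Tendsto (fun n => ∫ x, F (lap (Psi T a f n x), lap (Psi T a f' n x)) ∂Q) atTop
      (𝓝 (∫ ω, F (lap ((M ω).scale (integ m f)), lap ((M ω).scale (integ m f'))) ∂P)) := by
  obtain ⟨K, hK⟩ := hF
  obtain ⟨C, hC⟩ := hFb
  set c := integ m f with hc
  set c' := integ m f' with hc'
  -- For multiples of the single function `f₀` the pair is a continuous function of one path, so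
  -- convergence of one path is enough; `f` and `f'` are exchanged for these multiples at a
  -- vanishing cost.
  have hg : IsL1Pos m fun x => c * f₀ x := hf₀.const_mul c
  have hg' : IsL1Pos m fun x => c' * f₀ x := hf₀.const_mul c'
  have hgc : integ m f = integ m fun x => c * f₀ x := by rw [integ_const_mul hf₀, h₀, mul_one]
  have hgc' : integ m f' = integ m fun x => c' * f₀ x := by rw [integ_const_mul hf₀, h₀, mul_one]
  have hlim : Tendsto (fun n => ∫ x, F (lap ((Psi T a f₀ n x).scale c),
      lap ((Psi T a f₀ n x).scale c')) ∂Q) atTop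
      (𝓝 (∫ ω, F (lap ((M ω).scale c), lap ((M ω).scale c')) ∂P)) := by
    have := hconv f₀ hf₀ Q inferInstance hQ (BoundedContinuousFunction.ofNormedAddCommGroup
      (fun ξ => F (lap (ξ.scale c), lap (ξ.scale c')))
      (hK.continuous.comp ((continuous_lap_scale c).prodMk (continuous_lap_scale c'))) C
      fun ξ => hC _)
    have hs : ∀ ω, (M ω).scale (integ m f₀) = M ω := fun ω => by
      ext t; simp [NonDec.scale, h₀]
    simpa only [BoundedContinuousFunction.coe_ofNormedAddCommGroup, hs] using this
  simp only [← Psi_const_mul] at hlim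
  have hm : ∀ g, IsL1Pos m g → ∀ n, Measurable fun x => lap (Psi T a g n x) := fun g hg n =>
    measurable_lap.comp (measurable_Psi hT hg.1 n)
  have hFi : ∀ g g', IsL1Pos m g → IsL1Pos m g' → ∀ n,
      Integrable (fun x => F (lap (Psi T a g n x), lap (Psi T a g' n x))) Q := fun g g' hg hg' n =>
    (integrable_const C).mono' (hK.continuous.measurable.comp
      ((hm g hg n).prodMk (hm g' hg' n))).aestronglyMeasurable (ae_of_all _ fun x => hC _)
  have hdi : ∀ g g', IsL1Pos m g → IsL1Pos m g' → ∀ n,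
      Integrable (fun x => dist (lap (Psi T a g n x)) (lap (Psi T a g' n x))) Q := fun g g' hg hg' n =>
    (integrable_const (2 : ℝ)).mono' ((hm g hg n).dist (hm g' hg' n)).aestronglyMeasurable
      (ae_of_all _ fun x => by
        rw [Real.norm_eq_abs, abs_of_nonneg dist_nonneg]
        rw [dist_edist]
        exact ENNReal.toReal_le_of_le_ofReal zero_le_two (by simpa using PiCountable.edist_le_two))
  have hdiff : Tendsto (fun n => ∫ x, F (lap (Psi T a f n x), lap (Psi T a f' n x)) ∂Q -
      ∫ x, F (lap (Psi T a (fun x => c * f₀ x) n x), lap (Psi T a (fun x => c' * f₀ x) n x)) ∂Q)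
      atTop (𝓝 0) := by
    have hz := ((tendsto_integral_dist_lap hQ hT hconv hf hg hgc).add
      (tendsto_integral_dist_lap hQ hT hconv hf' hg' hgc')).const_mul (K : ℝ)
    rw [add_zero, mul_zero] at hz
    refine squeeze_zero_norm (fun n => ?_) hz
    rw [← integral_sub (hFi _ _ hf hf' n) (hFi _ _ hg hg' n),
      ← integral_add (hdi _ _ hf hg n) (hdi _ _ hf' hg' n), ← integral_const_mul]
    refine norm_integral_le_of_norm_le (((hdi _ _ hf hg n).add (hdi _ _ hf' hg' n)).const_mul _)
      (ae_of_all _ fun x => ?_)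
    rw [← dist_eq_norm]
    refine (hK.dist_le_mul _ _).trans ?_
    gcongr
    rw [Prod.dist_eq]
    exact max_le_add_of_nonneg dist_nonneg dist_nonneg
  simpa using hdiff.add hlim

end Joint

/-! ### Convergence of the weighted sums -/

section Main

variable {X Ω : Type*} [MeasurableSpace X] [MeasurableSpace Ω] {m : Measure X} {T : X → X}
  {a : ℕ → ℝ≥0} {R : Set (Set X)} {γ : ℝ} {P : Measure Ω} [IsProbabilityMeasure P] {M : Ω → DInf}
  {f f₀ : X → ℝ≥0} {g : DOne → ℝ} {A B : Set X}

/-- The normalized sum of `g (Psi k) 1_B ∘ T^k` over `1 ≤ k ≤ n`. -/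
def weightedSum {X : Type*} (T : X → X) (a : ℕ → ℝ≥0) (f : X → ℝ≥0) (g : DOne → ℝ) (B : Set X)
    (n : ℕ) (x : X) : ℝ :=
  ∑ i ∈ Finset.range n, g (Psi T a f (i + 1) x).toOne *
    ((T ⁻¹' B).indicator (1 : X → ℝ≥0) (T^[i] x) / a n : ℝ≥0)

theorem coe_indicator_div {X : Type*} (B : Set X) (c : ℝ≥0) (x : X) :
    ((B.indicator (1 : X → ℝ≥0) x / c : ℝ≥0) : ℝ) = B.indicator (1 : X → ℝ) x / c := by
  by_cases hx : x ∈ B <;> simp [hx]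

theorem abs_weightedSum_le {X : Type*} {T : X → X} {a : ℕ → ℝ≥0} {f : X → ℝ≥0} {g : DOne → ℝ}
    {C : ℝ} (hC : ∀ ξ, |g ξ| ≤ C) (B : Set X) (n : ℕ) (x : X) :
    |weightedSum T a f g B n x| ≤ C * occ T a (T ⁻¹' B) n x := by
  rw [weightedSum, occ, Finset.mul_sum]
  refine (Finset.abs_sum_le_sum_abs _ _).trans (Finset.sum_le_sum fun i _ => ?_)
  rw [abs_mul, coe_indicator_div, abs_of_nonneg (indicator_div_nonneg _ _ _)]
  exact mul_le_mul_of_nonneg_right (hC _) (indicator_div_nonneg _ _ _)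

theorem measurable_weightedSum (hT : Measurable T) (hf : Measurable f) (hg : Measurable g)
    (hB : MeasurableSet B) (n : ℕ) : Measurable (weightedSum T a f g B n) := by
  refine Finset.measurable_fun_sum _ fun i _ => Measurable.mul ?_ ?_
  · exact hg.comp (measurable_toOne.comp (measurable_Psi hT hf _))
  · exact measurable_coe_nnreal_real.comp
      (((measurable_one.indicator (hT hB)).comp (hT.iterate i)).div_const _)

theorem setIntegral_weightedSum (hT : Measurable T) (hf : Measurable f) (hg : IsCBc g)
    (hB : MeasurableSet B) (hA : m A ≠ ∞) (n : ℕ) :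
    ∫ x in A, weightedSum T a f g B n x ∂m = 1 / (a n : ℝ) * ∑ k ∈ Finset.Icc 1 n,
      ∫ x in A, g (Psi T a f k x).toOne * B.indicator 1 (T^[k] x) ∂m := by
  obtain ⟨C, hC⟩ := hg.bounded
  unfold weightedSum
  have hrange : ∀ φ : ℕ → ℝ, ∑ k ∈ Finset.Icc 1 n, φ k = ∑ i ∈ Finset.range n, φ (i + 1) := by
    intro φ
    rw [Finset.range_eq_Ico, Finset.sum_Ico_add' φ 0 n 1]
    rfl
  rw [hrange, integral_finsetSum, Finset.mul_sum]
  · refine Finset.sum_congr rfl fun i _ => ?_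
    rw [← integral_const_mul]
    refine integral_congr_ae (ae_of_all _ fun x => ?_)
    have hmem : (T ⁻¹' B).indicator (1 : X → ℝ) (T^[i] x) = B.indicator 1 (T^[i + 1] x) := by
      rw [Function.iterate_succ_apply']
      rfl
    simp only [coe_indicator_div, hmem]
    ring
  · intro i _
    refine Measure.integrableOn_of_bounded (M := C * (1 / a n)) hA ?_ (ae_of_all _ fun x => ?_)
    · refine (Measurable.mul ?_ ?_).aestronglyMeasurable
      · exact hg.measurable.comp (measurable_toOne.comp (measurable_Psi hT hf _))
      · exact measurable_coe_nnreal_real.comp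
          (((measurable_one.indicator (hT hB)).comp (hT.iterate i)).div_const _)
    · rw [Real.norm_eq_abs, abs_mul, coe_indicator_div, abs_of_nonneg (indicator_div_nonneg _ _ _)]
      exact mul_le_mul (hC _) (indicator_div_le _ _ _) (indicator_div_nonneg _ _ _)
        ((abs_nonneg _).trans (hC ((Psi T a f 0 x).toOne)))

/-- The mapping theorem is applied under `m` conditioned on `A`, with the pair of Laplace encodings
as the converging variables and `weightedSum` as the functional. Occupation times dominate
`weightedSum`, which supplies uniform integrability. -/
theorem tendsto_sum_setIntegral (hT : IsWeaklyRationallyErgodic m T a R)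
    (hreg : ∀ t > 0, Tendsto (fun q : ℕ × ℝ≥0 => a ⌊(q.1 : ℝ≥0) * q.2⌋₊ / a q.1) (atTop ×ˢ 𝓝 t)
      (𝓝 (t ^ γ)))
    (hM : Measurable M) (hMcont : ∀ᵐ ω ∂P, Continuous (M ω).toFun) (hM0 : ∀ᵐ ω ∂P, M ω 0 = 0)
    (hconv : ∀ f : X → ℝ≥0, IsL1Pos m f →
      StrongDistConv m (Psi T a f) P (fun ω => (M ω).scale (integ m f)))
    (hf₀ : IsL1Pos m f₀) (h₀ : integ m f₀ = 1) (hA : A ∈ R) (hB : B ∈ R) (hf : IsL1Pos m f)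
    (hg : IsCBc g) :
    Tendsto (fun n : ℕ => 1 / (a n : ℝ) * ∑ k ∈ Finset.Icc 1 n,
        ∫ x in A, g (Psi T a f k x).toOne * B.indicator 1 (T^[k] x) ∂m) atTop
      (𝓝 (m.real A * m.real B * ∫ ω, ∫ t in Icc 0 1,
        g (((M ω).dilate γ t).toOne.scale (integ m f)) ∂(M ω).measure ∂P)) := by
  have hTm := hT.measurePreserving.measurable
  have hBm := hT.measurableSet B hB
  have hAtop : m A ≠ ∞ := (hT.measure_lt_top A hA).ne
  simp only [← setIntegral_weightedSum hTm hf.1 hg hBm hAtop]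
  rcases eq_or_ne (m A) 0 with hA0 | hA0
  · simp [Measure.real, hA0, Measure.restrict_eq_zero.2 hA0]
  obtain ⟨C, hC⟩ := hg.bounded
  have hC0 : 0 ≤ C := (abs_nonneg _).trans (hC ((M (nonempty_of_isProbabilityMeasure P).some).toOne))
  set B' : Set X := T ⁻¹' B with hB'
  have hB'R : B' ∈ R := hT.invariant B hB
  have hB'm : MeasurableSet B' := hTm hBm
  set b : X → ℝ≥0 := B'.indicator 1 with hb
  have hbL : IsL1Pos m b := isL1Pos_indicator hB'm (hT.measure_lt_top B' hB'R)
  have hbint : (integ m b : ℝ) = m.real B := by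
    rw [hb, integ_indicator hB'm, hB', hT.measurePreserving.measure_preimage hBm.nullMeasurableSet]
    rfl
  set Q : Measure X := ProbabilityTheory.cond m A with hQ
  have : IsProbabilityMeasure Q := ProbabilityTheory.cond_isProbabilityMeasure_of_finite hA0 hAtop
  have hQm : Q ≪ m := ProbabilityTheory.cond_absolutelyContinuous
  have hQint : ∀ φ : X → ℝ, ∫ x, φ x ∂Q = (m.real A)⁻¹ * ∫ x in A, φ x ∂m := fun φ => by
    rw [hQ, ProbabilityTheory.cond, integral_smul_measure, ENNReal.toReal_inv, smul_eq_mul]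
    rfl
  have hmA : 0 < m.real A := ENNReal.toReal_pos hA0 hAtop
  have hGm : ∀ n, Measurable (weightedSum T a f g B n) := fun n =>
    measurable_weightedSum hTm hf.1 hg.measurable hBm n
  have hGi : ∀ n, Integrable (weightedSum T a f g B n) Q := fun n =>
    (integrable_const (C * (n / a n))).mono' (hGm n).aestronglyMeasurable (ae_of_all _ fun x =>
      (abs_weightedSum_le hC B n x).trans (mul_le_mul_of_nonneg_left (occ_le _ _ _) hC0))
  have hmain : Tendsto (fun n => ∫ x, weightedSum T a f g B n x ∂Q) atTop
      (𝓝 (∫ ω, integ m b * ∫ t in Icc 0 1,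
        g (((M ω).dilate γ t).toOne.scale (integ m f)) ∂(M ω).measure ∂P)) := by
    refine tendsto_integral_of_tendsto_of_uniformIntegrable
      (Y := fun n x => (lap (Psi T a f n x), lap (Psi T a b n x)))
      (Z := fun ω => (lap ((M ω).scale (integ m f)), lap ((M ω).scale (integ m b))))
      (fun n => ?_) ?_ (tendsto_integral_lap_pair hQm hTm hconv hf hbL hf₀ h₀) hGi ?_ ?_ ?_
    · exact ((measurable_lap.comp (measurable_Psi hTm hf.1 n)).prodMk
        (measurable_lap.comp (measurable_Psi hTm hbL.1 n))).aemeasurable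
    · exact ((measurable_lap.comp ((measurable_scale _).comp hM)).prodMk
        (measurable_lap.comp ((measurable_scale _).comp hM))).aemeasurable
    · exact ((stronglyMeasurable_setIntegral_dilate γ hM
        (hg.measurable.comp (measurable_scale (integ m f)))).const_mul _).aestronglyMeasurable
    · intro ε hε
      obtain ⟨K, hK0, hK⟩ := hT.exists_integral_occ_tail_le hA hB'R
        (ε := ε * m.real A / (C + 1)) (by positivity)
      refine ⟨C * K, fun n => ?_⟩
      have hti : IntegrableOn (fun x => max (occ T a B' n x - K) 0) A m :=
        ((integrableOn_occ hTm hB'm n hAtop).sub (integrableOn_const hAtop)).pos_part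
      have h1 : ∫ x in A, max (|weightedSum T a f g B n x| - C * K) 0 ∂m ≤
          ∫ x in A, C * max (occ T a B' n x - K) 0 ∂m := by
        refine integral_mono_of_nonneg (ae_of_all _ fun x => le_max_right _ _)
          (hti.const_mul C) (ae_of_all _ fun x => ?_)
        refine max_le ?_ (mul_nonneg hC0 (le_max_right _ _))
        have h2 := abs_weightedSum_le (T := T) (a := a) (f := f) hC B n x
        have h3 := mul_le_mul_of_nonneg_left (le_max_left (occ T a B' n x - K) 0) hC0
        simp only
        linarith
      rw [integral_const_mul] at h1
      have h4 : C * ∫ x in A, max (occ T a B' n x - K) 0 ∂m ≤ ε * m.real A := by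
        have h5 : 0 ≤ ∫ x in A, max (occ T a B' n x - K) 0 ∂m :=
          integral_nonneg fun x => le_max_right _ _
        have h6 := hK n
        rw [le_div_iff₀ (by positivity)] at h6
        nlinarith
      rw [hQint, inv_mul_le_iff₀ hmA, mul_comm (m.real A)]
      exact h1.trans h4
    · filter_upwards [hMcont, hM0] with ω hω hω0
      have hfst : Tendsto (fun p : ℕ × X => p.1) (comap Prod.fst atTop ⊓
          comap (fun p : ℕ × X => (lap (Psi T a f p.1 p.2), lap (Psi T a b p.1 p.2)))
            (𝓝 (lap ((M ω).scale (integ m f)), lap ((M ω).scale (integ m b))))) atTop :=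
        tendsto_comap.mono_left inf_le_left
      have hsnd : Tendsto (fun p : ℕ × X => (lap (Psi T a f p.1 p.2), lap (Psi T a b p.1 p.2)))
          (comap Prod.fst atTop ⊓
          comap (fun p : ℕ × X => (lap (Psi T a f p.1 p.2), lap (Psi T a b p.1 p.2)))
            (𝓝 (lap ((M ω).scale (integ m f)), lap ((M ω).scale (integ m b)))))
          (𝓝 (lap ((M ω).scale (integ m f)), lap ((M ω).scale (integ m b)))) :=
        tendsto_comap.mono_left inf_le_right
      -- Laplace coordinates are positive, so taking logarithms recovers convergence of the
      -- primitives, hence of the paths.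
      have hcum : ∀ {ξ : ℕ × X → DInf} {η : DInf} {L : Filter (ℕ × X)},
          Tendsto (fun p => lap (ξ p)) L (𝓝 (lap η)) → ∀ r,
            Tendsto (fun p => cumul (ξ p) (ratPt r)) L (𝓝 (cumul η (ratPt r))) := by
        intro ξ η L h r
        simp only [cumul_eq_neg_log_lap]
        exact ((Real.continuousAt_log (Real.exp_pos _).ne').tendsto.comp
          (tendsto_pi_nhds.1 h r)).neg
      have hsc0 : ∀ c : ℝ≥0, (M ω).scale c 0 = 0 := fun c => by simp [NonDec.scale, hω0]
      exact tendsto_sum_of_tendsto_Psi (x := fun p : ℕ × X => p.2) hT.pos hreg hfst hω hω0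
        (tendsto_apply_of_tendsto_cumul (continuous_scale hω _) (hsc0 _)
          (hcum ((continuous_fst.tendsto _).comp hsnd)))
        (tendsto_apply_of_tendsto_cumul (continuous_scale hω _) (hsc0 _)
          (hcum ((continuous_snd.tendsto _).comp hsnd))) hg
  have hfin := hmain.const_mul (m.real A)
  rw [integral_const_mul, hbint, ← mul_assoc] at hfin
  refine hfin.congr fun n => ?_
  rw [hQint, mul_inv_cancel_left₀ hmA.ne']

end Main

/-- A weakly rationally ergodic transformation of a non-zero measure has a set of positive measure
in its ring. -/
theorem IsWeaklyRationallyErgodic.exists_ne_zero {X : Type*} [MeasurableSpace X] {m : Measure X}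
    [SigmaFinite m] (hm : m ≠ 0) {T : X → X} {a : ℕ → ℝ≥0} {R : Set (Set X)}
    (hT : IsWeaklyRationallyErgodic m T a R) : ∃ A ∈ R, m A ≠ 0 := by
  obtain ⟨E, hE⟩ : ∃ n, m (spanningSets m n) ≠ 0 := by
    by_contra! h
    refine hm (Measure.measure_univ_eq_zero.1 ?_)
    rw [← iUnion_spanningSets m]
    exact measure_iUnion_null h
  obtain ⟨A, hA, hAE⟩ := hT.dense _ (measurableSet_spanningSets m E)
    (measure_spanningSets_lt_top m E) (m (spanningSets m E)) (pos_iff_ne_zero.2 hE)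
  refine ⟨A, hA, fun h0 => ?_⟩
  refine absurd hAE (not_lt.2 ?_)
  calc m (spanningSets m E) ≤ m (A ∪ symmDiff A (spanningSets m E)) := measure_mono fun x hx => by
        by_cases h : x ∈ A
        · exact Or.inl h
        · exact Or.inr (Or.inr ⟨hx, h⟩)
    _ ≤ m A + m (symmDiff A (spanningSets m E)) := measure_union_le _ _
    _ = _ := by rw [h0, zero_add]

theorem isCBc_one : IsCBc fun _ => (1 : ℝ) :=
  ⟨measurable_const, ⟨1, fun _ => by simp⟩, fun _ _ => continuousAt_const⟩

end TiedDown

end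

/-! ### The tied-down law and the limit theorem -/

theorem proposition4 {X : Type*} [TopologicalSpace X] [PolishSpace X] [MeasurableSpace X]
    [BorelSpace X] (m : Measure X) [SigmaFinite m] [NullSingletonClass m] (hm : m ≠ 0) (T : X → X)
    (a : ℕ → ℝ≥0) (R : Set (Set X)) (hT : IsWeaklyRationallyErgodic m T a R)
    (γ : ℝ) (hγ : γ ∈ Ioc (0 : ℝ) 1) (ha : IsRegularlyVarying γ a)
    {Ω : Type*} [MeasurableSpace Ω] (P : Measure Ω) [IsProbabilityMeasure P]
    (M : Ω → DInf) (hM : Measurable M) (hMcont : ∀ᵐ ω ∂P, Continuous (M ω).toFun)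
    (hM0 : ∀ᵐ ω ∂P, M ω 0 = 0)
    (hconv : ∀ f : X → ℝ≥0, IsL1Pos m f →
      StrongDistConv m (Psi T a f) P (fun ω => (M ω).scale (integ m f))) :
    ∃ W : ProbabilityMeasure DOne, IsTiedDownLaw γ P M W ∧
      (∀ W' : ProbabilityMeasure DOne, IsTiedDownLaw γ P M W' → W' = W) ∧
      ∀ A ∈ R, ∀ B ∈ R, ∀ f : X → ℝ≥0, IsL1Pos m f → ∀ g : DOne → ℝ, IsCBc g →
        Tendsto (fun n : ℕ => 1 / (a n : ℝ) * ∑ k ∈ Finset.Icc 1 n,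
            ∫ x in A, g (Psi T a f k x).toOne * B.indicator 1 (T^[k] x) ∂m)
          atTop (𝓝 (m.real A * m.real B *
            ∫ ξ, g (ξ.scale (integ m f)) ∂(W : Measure DOne))) := by
  obtain ⟨A₀, hA₀, hA₀0⟩ := hT.exists_ne_zero hm
  have hTm := hT.measurePreserving.measurable
  have hA₀m := hT.measurableSet A₀ hA₀
  have hA₀top := hT.measure_lt_top A₀ hA₀
  have hmA₀ : 0 < m.real A₀ := ENNReal.toReal_pos hA₀0 hA₀top.ne
  have hreg : ∀ t > 0, Tendsto (fun q : ℕ × ℝ≥0 => a ⌊(q.1 : ℝ≥0) * q.2⌋₊ / a q.1)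
      (atTop ×ˢ 𝓝 t) (𝓝 (t ^ γ)) := fun t ht => by
    -- `a` need not be monotone, but these correlation sums are, and they are asymptotic to `m(A₀)²
    -- a n`.
    refine ha.tendsto_prod hT.pos (S := fun n => ∑ k ∈ Finset.range n, m.real (A₀ ∩ T^[k] ⁻¹' A₀))
      (fun i j hij => ?_) (mul_pos hmA₀ hmA₀) ?_ ht
    · exact Finset.sum_le_sum_of_subset_of_nonneg (Finset.range_mono hij)
        fun _ _ _ => measureReal_nonneg
    · refine (hT.tendsto A₀ hA₀ A₀ hA₀).congr fun n => ?_
      rw [one_div, inv_mul_eq_div]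
  set f₀ : X → ℝ≥0 := fun x => (m A₀).toNNReal⁻¹ * A₀.indicator 1 x with hf₀
  have hind := isL1Pos_indicator hA₀m hA₀top
  have hf₀L : IsL1Pos m f₀ := hind.const_mul _
  have h₀ : integ m f₀ = 1 := by
    rw [hf₀, integ_const_mul hind, integ_indicator hA₀m]
    exact inv_mul_cancel₀ (ENNReal.toNNReal_pos hA₀0 hA₀top.ne).ne'
  have hmain := fun (A B : Set X) (hA : A ∈ R) (hB : B ∈ R) (f : X → ℝ≥0) (hf : IsL1Pos m f)
      (g : DOne → ℝ) (hg : IsCBc g) =>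
    tendsto_sum_setIntegral hT hreg hM hMcont hM0 hconv hf₀L h₀ hA hB hf hg
  -- For `g = 1` the limit is `m(A₀)² E M(1)`, while weak rational ergodicity for `A₀` and `T ⁻¹'
  -- A₀` gives `m(A₀)²`. This normalises the tied-down measure.
  have hmean : ∫ ω, (M ω 1 : ℝ) ∂P = 1 := by
    have h1 := hmain A₀ A₀ hA₀ hA₀ f₀ hf₀L _ isCBc_one
    have h2 := hT.tendsto A₀ hA₀ (T ⁻¹' A₀) (hT.invariant A₀ hA₀)
    have h3 : ∀ n : ℕ, 1 / (a n : ℝ) * ∑ k ∈ Finset.Icc 1 n,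
        ∫ x in A₀, (fun _ => (1 : ℝ)) (Psi T a f₀ k x).toOne * A₀.indicator 1 (T^[k] x) ∂m =
        1 / (a n : ℝ) * ∑ k ∈ Finset.range n, m.real (A₀ ∩ T^[k] ⁻¹' (T ⁻¹' A₀)) := by
      intro n
      rw [← setIntegral_weightedSum hTm hf₀L.1 isCBc_one hA₀m hA₀top.ne]
      have h4 : ∀ x, weightedSum T a f₀ (fun _ => 1) A₀ n x = occ T a (T ⁻¹' A₀) n x := fun x => by
        simp only [weightedSum, occ, one_mul, coe_indicator_div]
      simp only [h4]
      exact setIntegral_occ hTm (hTm hA₀m) n hA₀top.ne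
    simp only [h3] at h1
    have h5 := tendsto_nhds_unique h1 h2
    have h6 : m.real (T ⁻¹' A₀) = m.real A₀ := by
      rw [Measure.real, hT.measurePreserving.measure_preimage hA₀m.nullMeasurableSet]
      rfl
    have h7 : ∀ ω, ∫ _ in Icc (0 : ℝ≥0) 1, (1 : ℝ) ∂(M ω).measure = M ω 1 := fun ω => by
      rw [setIntegral_const, Measure.real, (M ω).measure_Icc_zero]
      simp
    rw [h6] at h5
    simp only [h7] at h5
    exact mul_left_cancel₀ (mul_pos hmA₀ hmA₀).ne' (h5.trans (mul_one _).symm)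
  have hlint : ∫⁻ ω, M ω 1 ∂P = 1 := by
    have hi : Integrable (fun ω => (M ω 1 : ℝ)) P := by
      -- A non-integrable function has Bochner integral `0` by convention, so a mean of `1` forces
      -- integrability.
      by_contra h
      rw [integral_undef h] at hmean
      exact zero_ne_one hmean
    have := ofReal_integral_eq_lintegral_ofReal hi (ae_of_all _ fun ω => NNReal.coe_nonneg _)
    simp only [ENNReal.ofReal_coe_nnreal] at this
    rw [← this, hmean, ENNReal.ofReal_one]
  have hprob : IsProbabilityMeasure (tiedDownMeasure γ P hM) :=
    ⟨by rw [tiedDownMeasure_univ, hlint]⟩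
  have hlaw := isTiedDownLaw_tiedDownMeasure γ hM hMcont
  refine ⟨⟨tiedDownMeasure γ P hM, hprob⟩, hlaw, fun W' hW' => ?_, ?_⟩
  · have hW'p : IsProbabilityMeasure (W' : Measure DOne) := W'.2
    exact Subtype.ext (ext_of_forall_integral_eq (W' : Measure DOne) _ fun h => (hW' h).trans (hlaw h).symm)
  · intro A hA B hB f hf g hg
    obtain ⟨C, hC⟩ := hg.bounded
    have h1 := integral_tiedDownMeasure (P := P) γ hM
      (hg.measurable.comp (measurable_scale (integ m f))) (C := C) fun ξ => hC _
    simp only [Function.comp_def] at h1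
    simp only [ProbabilityMeasure.coe_mk, h1]
    exact hmain A B hA hB f hf g hg
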